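/- Conventions. An $(a,b)$-module is a free $\mathbb{C}[[b]]$-module of finite rank with a $\mathbb{C}$-linear operator $a$ such that $ab-ba=b^2$. For $\lambda\in\mathbb{Q}$, $\lambda>0$, and $N\ge 1$, let $\Xi_\lambda^{(N-1)}=\bigoplus_{j=0}^{N-1}\mathbb{C}[[b]]\,e_j$, with $e_j=s^{\lambda-1}(\log s)^j/j!$, be the $(a,b)$-module with $a e_0=\lambda b e_0$ and $a e_j=\lambda b e_j+b e_{j-1}$ for $j\ge1$. Let $\tilde{\mathcal A}$ be the algebra of the series $\sum_\nu P_\nu(a)b^\nu$ with $P_\nu\in\mathbb{C}[x]$, with $ab-ba=b^2$; thus $\tilde{\mathcal A}v$ is the $\mathbb{C}[[b]]$-module generated by the $a^\nu v$, $\nu\ge0$. A $[\lambda]$-primitive theme of rank $k$ is an $(a,b)$-module isomorphic to a submodule $\tilde{\mathcal A}v$, of rank $k$ over $\mathbb{C}[[b]]$, of some $\Xi_\lambda^{(N-1)}$. Let $X$ be a reduced complex space. A change of variable relative to $X$ is an element $\theta\in\mathcal{O}(X)[[a]]$ with $\theta(0)=0$ and $\theta'(0)(x)\neq0$ for all $x\in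 X$; write $\theta_x\in\mathbb{C}[[a]]$ for its value at $x$. If $E$ is an $(a,b)$-module on which these $b$-adically convergent series make sense (for instance a theme), $(\theta_x)_*(E)$ is $E$ with $a$ acting by $\alpha=\theta_x(a)$ and $b$ acting by $\beta=b\,\theta_x'(a)$. For a holomorphic map $\varphi:U\to\Xi_\lambda^{(N-1)}$ on an open set $U\subset X$ (all coefficients are holomorphic), let $\mathbb{E}_\varphi$ be the sheaf on $U$ of $\mathcal{O}_X[[b]]$-modules generated by the $a^\nu\varphi$, $\nu\ge0$. The map $\varphi$ is $k$-thematic if $\tilde{\mathcal A}\varphi(x)$ has rank $k$ for every $x\in U$, if $\mathbb{E}_\varphi$ is free over $\mathcal{O}_X[[b]]$ with basis $\varphi,a\varphi,\dots,a^{k-1}\varphi$, and if $a^k\varphi\in b\,\mathbb{E}_\varphi$. The same definitions are used with operators $(\alpha,\beta)$ on $\Xi_\lambda^{(N-1)}$ (depending on $x$) in place of $(a,b)$. A family $(\mathbb{E}(x))_{x\in X}$ of $[\lambda]$-primitive themes of rank $k$ is holomorphic if every point of $X$ has an open neighbourhood $U$ with a $k$-thematic map $\varphi:U\to\Xi_\lambda^{(N-1)}$,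 for some $N\ge1$, and isomorphisms $\mathbb{E}(x)\simeq\tilde{\mathcal A}\varphi(x)$ for $x\in U$. If a sheaf $\mathbb{E}$ of sections of the family is given, the family is holomorphic with its sheaf if moreover these isomorphisms can be chosen so that they identify $\mathbb{E}|_U$ with $\mathbb{E}_\varphi$. Theorem. Let $X$ be a reduced complex space, $\lambda\in\mathbb{Q}$ with $\lambda>0$, $k\ge0$, and $\theta\in\mathcal{O}(X)[[a]]$ a change of variable relative to $X$. (1) Let $\varphi:X\to\Xi_\lambda^{(N-1)}$ be $k$-thematic, and put $\alpha=\theta(a)$ and $\beta=b\,\theta'(a)$. Then $\mathbb{E}_\varphi$ is stable under $\alpha$ and is a free $\mathcal{O}_X[[\beta]]$-module with basis $\varphi,\alpha\varphi,\dots,\alpha^{k-1}\varphi$; and $\varphi$ is $k$-thematic for the structure on $\Xi_\lambda^{(N-1)}$ given by $\alpha$ and $\beta$. (2) Let $(\mathbb{E}(x))_{x\in X}$ be a holomorphic family of $[\lambda]$-primitive themes of rank $k$. Then the family of the $(\theta_x)_*(\mathbb{E}(x))$, $x\in X$, is a holomorphic family of $[\lambda]$-primitive themes of rank $k$. If moreover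 $(\mathbb{E}(x))_{x\in X}$ is holomorphic with a sheaf $\mathbb{E}$ of sections, then so is the family of the $(\theta_x)_*(\mathbb{E}(x))$, with the same sheaf, on which $a$ and $b$ now act by $\alpha$ and $\beta$. -/

import Mathlib

namespace Theme

/-! ### Reduced complex spaces -/

/-- The structure of a reduced complex space on a topological space `X`, given by its structure
sheaf, which is a sheaf of complex valued functions. The sheaf is recorded by the predicate
`HolAt f x` (the germ at `x` of `f` is a germ of holomorphic function); a section over an open set
`V` is a function which satisfies it at all points of `V`, see `HolOn`. Around each point `x`, the
space is isomorphic (by `χ`) to a local model: the set of common zeros of finitely many holomorphic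
functions on an open subset `D` of `ℂⁿ`, where the holomorphic germs are the restrictions of the
germs of holomorphic functions on `ℂⁿ`. -/
structure ReducedComplexSpace (X : Type*) [TopologicalSpace X] where
  HolAt : (X → ℂ) → X → Prop
  exists_local_model : ∀ x : X, ∃ (n m : ℕ) (U : Set X) (D : Set (Fin n → ℂ))
    (g : Fin m → (Fin n → ℂ) → ℂ) (χ : X → Fin n → ℂ),
      IsOpen U ∧ x ∈ U ∧ IsOpen D ∧ (∀ i, AnalyticOnNhd ℂ (g i) D) ∧
      Topology.IsEmbedding (U.domRestrict χ) ∧ χ '' U = {z | z ∈ D ∧ ∀ i, g i z = 0} ∧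
      ∀ y ∈ U, ∀ f : X → ℂ, HolAt f y ↔
        ∃ F : (Fin n → ℂ) → ℂ, AnalyticAt ℂ F (χ y) ∧ ∀ᶠ u in nhds y, f u = F (χ u)

section Holomorphic

variable {X : Type*} [TopologicalSpace X]

/-- `f` is holomorphic on `V`: for `V` open, the restriction of `f` to `V` is in `𝒪(V)`. -/
def ReducedComplexSpace.HolOn (𝒪 : ReducedComplexSpace X) (V : Set X) (f : X → ℂ) : Prop :=
  ∀ x ∈ V, 𝒪.HolAt f x

/-- `S` is, over the open set `V`, an element of `𝒪(V)[[b]]`; its value at `x` is the element of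
`ℂ[[b]]` obtained by evaluating the coefficients at `x`. -/
def ReducedComplexSpace.HolSeriesOn (𝒪 : ReducedComplexSpace X) (V : Set X)
    (S : X → PowerSeries ℂ) : Prop :=
  ∀ n : ℕ, 𝒪.HolOn V (fun x => PowerSeries.coeff n (S x))

/-- A change of variable relative to `X`: an element `θ` of `𝒪(X)[[a]]` with `θ(0) = 0` and
`θ'(0)(x) ≠ 0` for all `x`. -/
def IsRelativeChangeOfVariable (𝒪 : ReducedComplexSpace X) (θ : X → PowerSeries ℂ) : Prop :=
  𝒪.HolSeriesOn Set.univ θ ∧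
    ∀ x, PowerSeries.coeff 0 (θ x) = 0 ∧ PowerSeries.coeff 1 (θ x) ≠ 0

end Holomorphic

/-! ### Vector spaces with two operators `a`, `b` -/

section Operators

variable {E : Type*} [AddCommGroup E] [Module ℂ E]

/-- The series `∑ Sₙ uⁿ v` converges to `w` for the `b`-adic topology of `E`. -/
def HasSeriesSum (b u : Module.End ℂ E) (S : PowerSeries ℂ) (v w : E) : Prop :=
  ∀ m : ℕ, ∃ n₀ : ℕ, ∀ n ≥ n₀,
    w - ∑ i ∈ Finset.range n, PowerSeries.coeff i S • (u ^ i) v ∈ LinearMap.range (b ^ m)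

open Classical in
/-- The operator `S(u) = ∑ Sₙ uⁿ`, the series being summed for the `b`-adic topology of `E`
(and `0` if this does not define a unique operator). -/
noncomputable def seriesOp (b u : Module.End ℂ E) (S : PowerSeries ℂ) : Module.End ℂ E :=
  if h : ∃! L : Module.End ℂ E, ∀ v, HasSeriesSum b u S v (L v) then h.choose else 0

/-- The action of `S ∈ ℂ[[b]]` on `E`. -/
noncomputable abbrev bSeries (b : Module.End ℂ E) (S : PowerSeries ℂ) : Module.End ℂ E :=
  seriesOp b b S

/-- The operator `α = θ(a)`, by which `a` acts on `θ_*(E)`. -/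
noncomputable def changeA (a b : Module.End ℂ E) (θ : PowerSeries ℂ) : Module.End ℂ E :=
  seriesOp b a θ

/-- The operator `β = b θ'(a)`, by which `b` acts on `θ_*(E)`. -/
noncomputable def changeB (a b : Module.End ℂ E) (θ : PowerSeries ℂ) : Module.End ℂ E :=
  b * seriesOp b a (PowerSeries.derivative ℂ θ)

/-- The submodule generated by `v` under `a` and `ℂ[[b]]`: the `ℂ[[b]]`-module generated by the
`a^ν v`, that is `𝒜̃ v`. -/
noncomputable def cyclic (a b : Module.End ℂ E) (v : E) : Submodule ℂ E :=
  Submodule.span ℂ {w | ∃ (S : PowerSeries ℂ) (ν : ℕ), w = bSeries b S ((a ^ ν) v)}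

/-- `P` is a free `ℂ[[b]]`-module of rank `k`: it has a basis with `k` elements. -/
def IsFreeOfRank (b : Module.End ℂ E) (k : ℕ) (P : Submodule ℂ E) : Prop :=
  ∃ e : Fin k → E,
    (∀ w, w ∈ P ↔ ∃ S : Fin k → PowerSeries ℂ, w = ∑ i, bSeries b (S i) (e i)) ∧
    ∀ S : Fin k → PowerSeries ℂ, ∑ i, bSeries b (S i) (e i) = 0 → ∀ i, S i = 0

/-- `f` is an isomorphism, compatible with the operators `a` and `b`, of `E` onto the submodule
`P` of `M`. -/
def IsIsoOnto {M : Type*} [AddCommGroup M] [Module ℂ M] (a b : Module.End ℂ E)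
    (a' b' : Module.End ℂ M) (P : Submodule ℂ M) (f : E →ₗ[ℂ] M) : Prop :=
  Function.Injective f ∧ LinearMap.range f = P ∧
    (∀ v, f (a v) = a' (f v)) ∧ ∀ v, f (b v) = b' (f v)

end Operators

/-! ### The modules `Ξ_λ^{(N-1)}` and themes -/

/-- `Ξ_λ^{(N-1)}`, free over `ℂ[[b]]` with basis `e_j = s^{λ-1} (log s)^j / j!`, `0 ≤ j < N`. -/
abbrev Xi (N : ℕ) : Type := Fin N → PowerSeries ℂ

/-- The action of `b` on `Ξ_λ^{(N-1)}`. -/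
noncomputable def xiB (N : ℕ) : Module.End ℂ (Xi N) where
  toFun v := fun j => PowerSeries.X * v j
  map_add' v w := by
    funext j
    simp [mul_add]
  map_smul' c v := by
    funext j
    simp

/-- The action of `a` on `Ξ_λ^{(N-1)}`, given by `a e_0 = λ b e_0`, `a e_j = λ b e_j + b e_{j-1}`
and `a S = S a + b² S'` for `S ∈ ℂ[[b]]`. -/
noncomputable def xiA (lam : ℚ) (N : ℕ) : Module.End ℂ (Xi N) where
  toFun v := fun j => (lam : ℂ) • (PowerSeries.X * v j)
    + (if h : (j : ℕ) + 1 < N then PowerSeries.X * v ⟨(j : ℕ) + 1, h⟩ else 0)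
    + PowerSeries.X ^ 2 * PowerSeries.derivative ℂ (v j)
  map_add' v w := by
    funext j
    by_cases h : (j : ℕ) + 1 < N
    · simp only [h, Pi.add_apply, dif_pos, mul_add, smul_add, map_add]
      abel
    · simp only [h, Pi.add_apply, dif_neg, mul_add, smul_add, map_add,
        not_false_eq_true]
      abel
  map_smul' c v := by
    funext j
    by_cases h : (j : ℕ) + 1 < N
    · simp [h, smul_add, smul_comm c (lam : ℂ)]
    · simp [h, smul_add, smul_comm c (lam : ℂ)]

/-- `E`, with the operators `a` and `b`, is a `[λ]`-primitive theme of rank `k`: it is isomorphic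
to a submodule `𝒜̃ v` of rank `k` of some `Ξ_λ^{(N-1)}`. -/
def IsPrimitiveTheme (lam : ℚ) (k : ℕ) {E : Type*} [AddCommGroup E] [Module ℂ E]
    (a b : Module.End ℂ E) : Prop :=
  ∃ N : ℕ, 0 < N ∧ ∃ v : Xi N, IsFreeOfRank (xiB N) k (cyclic (xiA lam N) (xiB N) v) ∧
    ∃ f : E →ₗ[ℂ] Xi N, IsIsoOnto a b (xiA lam N) (xiB N) (cyclic (xiA lam N) (xiB N) v) f

/-! ### Holomorphic families of themes -/

section Families

variable {X : Type*} [TopologicalSpace X]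

/-- The map `φ` with values in `Ξ_λ^{(N-1)}` is holomorphic on `V`. -/
def HolMapOn (𝒪 : ReducedComplexSpace X) (V : Set X) {N : ℕ} (φ : X → Xi N) : Prop :=
  ∀ j, 𝒪.HolSeriesOn V (fun x => φ x j)

/-- `ψ` is, near `y`, a section of the sheaf `𝔼_φ`, the sheaf of `𝒪_X[[B]]`-modules generated by
the `A^ν φ`, `ν ≥ 0`. The operators `A` and `B` act on `Ξ_λ^{(N-1)}` and may depend on the point. -/
def IsSectionAt (𝒪 : ReducedComplexSpace X) {N : ℕ} (A B : X → Module.End ℂ (Xi N))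
    (φ : X → Xi N) (y : X) (ψ : X → Xi N) : Prop :=
  ∃ W : Set X, IsOpen W ∧ y ∈ W ∧ ∃ (n : ℕ) (S : ℕ → X → PowerSeries ℂ),
    (∀ ν, 𝒪.HolSeriesOn W (S ν)) ∧
    ∀ x ∈ W, ψ x = ∑ ν ∈ Finset.range n, bSeries (B x) (S ν x) ((A x ^ ν) (φ x))

/-- `ψ` is a section over `V` of the sheaf `𝔼_φ`. -/
def IsSectionOn (𝒪 : ReducedComplexSpace X) {N : ℕ} (A B : X → Module.End ℂ (Xi N))
    (φ : X → Xi N) (V : Set X) (ψ : X → Xi N) : Prop :=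
  ∀ y ∈ V, IsSectionAt 𝒪 A B φ y ψ

/-- The sheaf on `U` with sections `sec V` over `V` is free over `𝒪_X[[B]]` with basis the
sections `e i`. -/
def IsSheafBasis (𝒪 : ReducedComplexSpace X) (U : Set X) {N k : ℕ}
    (B : X → Module.End ℂ (Xi N)) (sec : Set X → (X → Xi N) → Prop)
    (e : Fin k → X → Xi N) : Prop :=
  ∀ V : Set X, IsOpen V → V ⊆ U →
    (∀ ψ, sec V ψ ↔ ∃ S : Fin k → X → PowerSeries ℂ, (∀ i, 𝒪.HolSeriesOn V (S i)) ∧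
      ∀ x ∈ V, ψ x = ∑ i, bSeries (B x) (S i x) (e i x)) ∧
    ∀ S : Fin k → X → PowerSeries ℂ, (∀ i, 𝒪.HolSeriesOn V (S i)) →
      (∀ x ∈ V, ∑ i, bSeries (B x) (S i x) (e i x) = 0) → ∀ i, ∀ x ∈ V, S i x = 0

/-- The map `φ` is `k`-thematic on the open set `U`, for the structure on `Ξ_λ^{(N-1)}` given by
the operators `A` and `B`: it is holomorphic, each `φ x` generates a module of rank `k`, the sheaf
`𝔼_φ` is free over `𝒪_X[[B]]` with basis `φ, A φ, …, A^{k-1} φ`, and `A^k φ` is in `B 𝔼_φ`. -/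
structure IsThematic (𝒪 : ReducedComplexSpace X) (U : Set X) {N : ℕ}
    (A B : X → Module.End ℂ (Xi N)) (k : ℕ) (φ : X → Xi N) : Prop where
  hol : HolMapOn 𝒪 U φ
  rank : ∀ x ∈ U, IsFreeOfRank (B x) k (cyclic (A x) (B x) (φ x))
  basis : IsSheafBasis 𝒪 U B (IsSectionOn 𝒪 A B φ)
    (fun (i : Fin k) x => (A x ^ (i : ℕ)) (φ x))
  pow_mem : ∃ ψ, IsSectionOn 𝒪 A B φ U ψ ∧ ∀ x ∈ U, (A x ^ k) (φ x) = B x (ψ x)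

variable {E : X → Type*} [∀ x, AddCommGroup (E x)] [∀ x, Module ℂ (E x)]

/-- The family of the `E x`, with operators `a x` and `b x`, is a holomorphic family of
`[λ]`-primitive themes of rank `k`: each `E x` is such a theme and, locally on `X`, there is a
`k`-thematic map `φ` with `E x ≅ 𝒜̃ φ(x)`. -/
def IsHolomorphicFamily (𝒪 : ReducedComplexSpace X) (lam : ℚ) (k : ℕ)
    (a b : ∀ x, Module.End ℂ (E x)) : Prop :=
  (∀ x, IsPrimitiveTheme lam k (a x) (b x)) ∧
  ∀ x₀ : X, ∃ U : Set X, IsOpen U ∧ x₀ ∈ U ∧ ∃ (N : ℕ) (φ : X → Xi N), 0 < N ∧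
    IsThematic 𝒪 U (fun _ => xiA lam N) (fun _ => xiB N) k φ ∧
    ∀ x ∈ U, ∃ f : E x →ₗ[ℂ] Xi N,
      IsIsoOnto (a x) (b x) (xiA lam N) (xiB N) (cyclic (xiA lam N) (xiB N) (φ x)) f

/-- The same with a sheaf: `sec y s` says that `s`, near `y`, is a section of a given sheaf `𝔼` of
sections of the family of the `E x`. Locally on `X`, there are a `k`-thematic map `φ` and
isomorphisms `E x ≅ 𝒜̃ φ(x)` that identify the sheaf `𝔼` with the sheaf `𝔼_φ`. -/
def IsHolomorphicSheaf (𝒪 : ReducedComplexSpace X) (lam : ℚ) (k : ℕ)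
    (a b : ∀ x, Module.End ℂ (E x)) (sec : X → (∀ x, E x) → Prop) : Prop :=
  (∀ x, IsPrimitiveTheme lam k (a x) (b x)) ∧
  ∀ x₀ : X, ∃ U : Set X, IsOpen U ∧ x₀ ∈ U ∧ ∃ (N : ℕ) (φ : X → Xi N), 0 < N ∧
    IsThematic 𝒪 U (fun _ => xiA lam N) (fun _ => xiB N) k φ ∧
    ∃ f : ∀ x, E x →ₗ[ℂ] Xi N,
      (∀ x ∈ U, IsIsoOnto (a x) (b x) (xiA lam N) (xiB N)
        (cyclic (xiA lam N) (xiB N) (φ x)) (f x)) ∧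
      ∀ y ∈ U, ∀ s : ∀ x, E x, sec y s ↔
        IsSectionAt 𝒪 (fun _ => xiA lam N) (fun _ => xiB N) φ y (fun x => f x (s x))

end Families

end Theme

/-! Everything rests on one algebraic fact over a commutative ring R. Let M be a `b`-complete
R-module with `b` injective, ab - ba = b², and `a` nilpotent modulo `b` (`IsABModule`). Then power
series in `a` act on M, and S(a)b = bS(a) + bS'(a)b. For a change of variable θ, the operator θ'(a)
is invertible and preserves the `b`-adic filtration, so β = bθ'(a) satisfies β^m M = b^m M, and (α,
β) satisfies the same axioms (`IsABModule.change`). Bases over R[[β]] can therefore be tested modulo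
`b`, in a Nakayama-type argument (`expansion_bijective_of_isUnit_det`).

For part (1), a thematic map gives a relation a^k φ = b ∑ Sᵢ aⁱ φ with holomorphic coefficients.
Over R = 𝒪(W) this relation defines a companion module R[[b]]^k with a distinguished generator;
modulo `b` it is R[a]/(a^k). There αⁱ = aⁱη(a)ⁱ, where θ = Xη with η a unit. The matrix of the
powers of α is thus triangular with unit diagonal entries, and α^k vanishes modulo `b`
(`expansion_companion_bijective`, `change_pow_gen_mem_range`). Evaluation at a point is semilinear
and commutes with operator series (`map_opSeries`), so these facts over 𝒪(W) become statements about
sections, with holomorphic coefficients. Pointwise independence of the aⁱ φ(x) comes from the rank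
hypothesis (`expansion_injective_of_isFreeOfRank`) and lets local coefficients glue.

For part (2), the transformed themes must be embedded again in Ξ with its original operators. The
functions θ(s)^{λ-1}(log θ(s))^j/j! suggest how: since θ = sη, they expand in s^{λ-1}(log s)^i/i!
with coefficients η^{λ-1}(log η)^{j-i}/(j-i)!. Normalized to be the standard basis modulo `b`, they
give a family on which α acts over ℂ[[β]] by the matrix of `a` (`exists_xi_family`), hence
isomorphisms T(x) from (Ξ, a, b) to (Ξ, α, β) whose inverses preserve holomorphic maps
(`exists_conjugation`). The maps T(x)⁻¹φ(x) and T(x)⁻¹ ∘ f are the required local data, and the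
sheaf of sections is the same by part (1).

Over ℂ, `opSeries` and `changedB` unfold to `seriesOp` and `changeB`, which is why many
identifications are by `rfl`. -/

namespace Theme

/-! ### Operator series over a commutative ring -/

section OperatorSeries

variable {R M : Type*} [CommRing R] [AddCommGroup M] [Module R M]

/-- The series `∑ Sₙ uⁿ v` converges to `w` for the `b`-adic topology. -/
def SeriesConverges (b u : Module.End R M) (S : PowerSeries R) (v w : M) : Prop :=
  ∀ m : ℕ, ∃ n₀ : ℕ, ∀ n ≥ n₀,
    w - ∑ i ∈ Finset.range n, PowerSeries.coeff i S • (u ^ i) v ∈ LinearMap.range (b ^ m)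

open Classical in
/-- The operator `S(u) = ∑ Sₙ uⁿ` over a general base ring. -/
noncomputable def opSeries (b u : Module.End R M) (S : PowerSeries R) : Module.End R M :=
  if h : ∃! L : Module.End R M, ∀ v, SeriesConverges b u S v (L v) then h.choose else 0

/-- The module is separated and complete for the `b`-adic topology, and `b` is injective. -/
structure IsBComplete (b : Module.End R M) : Prop where
  injective : Function.Injective b
  separated : ∀ v, (∀ n, v ∈ LinearMap.range (b ^ n)) → v = 0
  complete : ∀ u : ℕ → M, (∀ n, u n ∈ LinearMap.range (b ^ n)) →
    ∃ w, ∀ n, w - ∑ i ∈ Finset.range n, u i ∈ LinearMap.range (b ^ n)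

/-- `u` respects the `b`-adic filtration and a power of `u` shifts it by one. -/
structure IsContracting (b u : Module.End R M) : Prop where
  stable : ∀ m v, v ∈ LinearMap.range (b ^ m) → u v ∈ LinearMap.range (b ^ m)
  exists_pow : ∃ K, ∀ m v, v ∈ LinearMap.range (b ^ m) →
    (u ^ K) v ∈ LinearMap.range (b ^ (m + 1))

variable {b u : Module.End R M}

lemma range_pow_antitone (b : Module.End R M) {m n : ℕ} (h : m ≤ n) :
    LinearMap.range (b ^ n) ≤ LinearMap.range (b ^ m) := by
  rintro _ ⟨v, rfl⟩
  obtain ⟨c, rfl⟩ := Nat.exists_eq_add_of_le h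
  exact ⟨(b ^ c) v, by rw [pow_add, Module.End.mul_apply]⟩

lemma IsContracting.pow_stable (hu : IsContracting b u) (i m : ℕ) {v : M}
    (hv : v ∈ LinearMap.range (b ^ m)) : (u ^ i) v ∈ LinearMap.range (b ^ m) := by
  induction i with
  | zero => simpa using hv
  | succ i ih =>
    rw [pow_succ', Module.End.mul_apply]
    exact hu.stable _ _ ih

lemma IsContracting.aeval_stable (hu : IsContracting b u) (p : Polynomial R) (m : ℕ) {v : M}
    (hv : v ∈ LinearMap.range (b ^ m)) :
    Polynomial.aeval u p v ∈ LinearMap.range (b ^ m) := by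
  rw [Polynomial.aeval_eq_sum_range, LinearMap.sum_apply]
  exact Submodule.sum_mem _ fun i _ => Submodule.smul_mem _ _ (hu.pow_stable i m hv)

lemma IsContracting.exists_pow_mem (hu : IsContracting b u) :
    ∃ K, ∀ m n, K * m ≤ n → ∀ v, (u ^ n) v ∈ LinearMap.range (b ^ m) := by
  obtain ⟨K, hK⟩ := hu.exists_pow
  have key : ∀ m v, (u ^ (K * m)) v ∈ LinearMap.range (b ^ m) := by
    intro m
    induction m with
    | zero => intro v; exact ⟨v, by simp⟩
    | succ m ih =>
      intro v
      rw [Nat.mul_succ, add_comm (K * m), pow_add u, Module.End.mul_apply]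
      exact hK _ _ (ih v)
  refine ⟨K, fun m n h v => ?_⟩
  obtain ⟨c, rfl⟩ := Nat.exists_eq_add_of_le h
  rw [pow_add, Module.End.mul_apply]
  exact key m _

lemma SeriesConverges.unique (hb : IsBComplete b) {S : PowerSeries R} {v w w' : M}
    (h : SeriesConverges b u S v w) (h' : SeriesConverges b u S v w') : w = w' := by
  rw [← sub_eq_zero]
  refine hb.separated _ fun m => ?_
  obtain ⟨n, hn⟩ := h m
  obtain ⟨n', hn'⟩ := h' m
  have := Submodule.sub_mem _ (hn (max n n') (le_max_left _ _)) (hn' (max n n') (le_max_right _ _))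
  simpa using this

/-- Beyond index K * m every term lies in b^m M. The partial sums at the indices K * m thus have
increments to which completeness applies, and the other partial sums follow them. -/
lemma exists_seriesConverges (hb : IsBComplete b) (hu : IsContracting b u) (S : PowerSeries R)
    (v : M) : ∃ w, SeriesConverges b u S v w := by
  obtain ⟨K, hK⟩ := hu.exists_pow_mem
  set s : ℕ → M := fun n => ∑ i ∈ Finset.range n, PowerSeries.coeff i S • (u ^ i) v with hs
  have hd : ∀ m n, K * m ≤ n → s n - s (K * m) ∈ LinearMap.range (b ^ m) := by
    intro m n h
    simp only [hs]
    rw [← Finset.sum_range_add_sum_Ico _ h, add_sub_cancel_left]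
    refine Submodule.sum_mem _ fun i hi => Submodule.smul_mem _ _ (hK m i ?_ v)
    exact (Finset.mem_Ico.mp hi).1
  obtain ⟨w, hw⟩ := hb.complete (fun m => s (K * (m + 1)) - s (K * m))
    (fun m => hd m _ (Nat.mul_le_mul_left K (Nat.le_succ m)))
  refine ⟨w, fun m => ⟨K * m, fun n hn => ?_⟩⟩
  have h1 := hw m
  rw [Finset.sum_range_sub (fun m => s (K * m))] at h1
  have h2 := Submodule.sub_mem _ h1 (hd m n hn)
  have h0 : s (K * 0) = 0 := by simp [hs]
  have : w - s n = w - (s (K * m) - s (K * 0)) - (s n - s (K * m)) := by rw [h0]; abel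
  change w - s n ∈ _
  rw [this]
  exact h2

lemma opSeries_spec (hb : IsBComplete b) (hu : IsContracting b u) (S : PowerSeries R) (v : M) :
    SeriesConverges b u S v (opSeries b u S v) := by
  have h : ∃! L : Module.End R M, ∀ v, SeriesConverges b u S v (L v) := by
    choose f hf using exists_seriesConverges hb hu S
    refine ⟨⟨⟨f, fun v w => ?_⟩, fun c v => ?_⟩, hf, fun L hL => ?_⟩
    · refine (hf (v + w)).unique hb fun m => ?_
      obtain ⟨n, hn⟩ := hf v m
      obtain ⟨n', hn'⟩ := hf w m
      refine ⟨max n n', fun l hl => ?_⟩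
      have := Submodule.add_mem _ (hn l (le_trans (le_max_left _ _) hl))
        (hn' l (le_trans (le_max_right _ _) hl))
      simp only [map_add, smul_add, Finset.sum_add_distrib]
      rwa [add_sub_add_comm]
    · refine (hf (c • v)).unique hb fun m => ?_
      obtain ⟨n, hn⟩ := hf v m
      refine ⟨n, fun l hl => ?_⟩
      have := Submodule.smul_mem _ c (hn l hl)
      simp only [map_smul, RingHom.id_apply]
      rw [smul_sub, Finset.smul_sum] at this
      simpa only [smul_comm c] using this
    · ext v
      exact (hL v).unique hb (hf v)
  rw [opSeries, dif_pos h]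
  exact h.choose_spec.1 v

lemma opSeries_eq_of_seriesConverges (hb : IsBComplete b) (hu : IsContracting b u)
    {S : PowerSeries R} {v w : M} (h : SeriesConverges b u S v w) : opSeries b u S v = w :=
  (opSeries_spec hb hu S v).unique hb h

/-- The polynomial `p` agrees with the series `S` in degrees less than `n`. -/
def AgreeUpTo (n : ℕ) (p : Polynomial R) (S : PowerSeries R) : Prop :=
  ∀ i < n, p.coeff i = PowerSeries.coeff i S

lemma agreeUpTo_trunc (n : ℕ) (S : PowerSeries R) : AgreeUpTo n (PowerSeries.trunc n S) S :=
  fun i hi => by rw [PowerSeries.coeff_trunc, if_pos hi]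

lemma AgreeUpTo.mono {n n' : ℕ} (h : n ≤ n') {p : Polynomial R} {S : PowerSeries R}
    (hp : AgreeUpTo n' p S) : AgreeUpTo n p S :=
  fun i hi => hp i (hi.trans_le h)

lemma AgreeUpTo.mul {n : ℕ} {p q : Polynomial R} {S T : PowerSeries R} (hp : AgreeUpTo n p S)
    (hq : AgreeUpTo n q T) : AgreeUpTo n (p * q) (S * T) := by
  intro i hi
  rw [Polynomial.coeff_mul, PowerSeries.coeff_mul]
  refine Finset.sum_congr rfl fun x hx => ?_
  have := Finset.HasAntidiagonal.mem_antidiagonal.mp hx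
  rw [hp _ (by omega), hq _ (by omega)]

lemma AgreeUpTo.add {n : ℕ} {p q : Polynomial R} {S T : PowerSeries R} (hp : AgreeUpTo n p S)
    (hq : AgreeUpTo n q T) : AgreeUpTo n (p + q) (S + T) := by
  intro i hi
  rw [Polynomial.coeff_add, map_add, hp _ hi, hq _ hi]

lemma AgreeUpTo.derivative {n : ℕ} {p : Polynomial R} {S : PowerSeries R}
    (hp : AgreeUpTo (n + 1) p S) :
    AgreeUpTo n (Polynomial.derivative p) (PowerSeries.derivative R S) := by
  intro i hi
  rw [Polynomial.coeff_derivative, PowerSeries.coeff_derivative, hp _ (by omega)]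

lemma agreeUpTo_coe (n : ℕ) (p : Polynomial R) : AgreeUpTo n p (p : PowerSeries R) :=
  fun i _ => by rw [Polynomial.coeff_coe]

/-- The order of truncation does not depend on the vector. This reduces identities between operator
series to identities between polynomials, modulo every power of `b`. -/
lemma opSeries_sub_aeval_mem (hb : IsBComplete b) (hu : IsContracting b u) (S : PowerSeries R)
    (m : ℕ) : ∃ n₀, ∀ p, AgreeUpTo n₀ p S → ∀ v,
      opSeries b u S v - Polynomial.aeval u p v ∈ LinearMap.range (b ^ m) := by
  obtain ⟨K, hK⟩ := hu.exists_pow_mem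
  refine ⟨K * m, fun p hp v => ?_⟩
  obtain ⟨n₁, hn₁⟩ := opSeries_spec hb hu S v m
  set n := max n₁ (p.natDegree + 1) with hn
  have h1 := hn₁ n (le_max_left _ _)
  have h2 : Polynomial.aeval u p v = ∑ i ∈ Finset.range n, p.coeff i • (u ^ i) v := by
    rw [Polynomial.aeval_eq_sum_range' (n := n)
      (lt_of_lt_of_le (Nat.lt_succ_self _) (le_max_right _ _)), LinearMap.sum_apply]
    rfl
  have h3 : ∑ i ∈ Finset.range n, PowerSeries.coeff i S • (u ^ i) v - Polynomial.aeval u p v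
      ∈ LinearMap.range (b ^ m) := by
    rw [h2, ← Finset.sum_sub_distrib]
    refine Submodule.sum_mem _ fun i _ => ?_
    rcases lt_or_ge i (K * m) with hi | hi
    · rw [hp i hi, sub_self]; exact Submodule.zero_mem _
    · exact Submodule.sub_mem _ (Submodule.smul_mem _ _ (hK _ _ hi _))
        (Submodule.smul_mem _ _ (hK _ _ hi _))
  have := Submodule.add_mem _ h1 h3
  simpa using this

lemma opSeries_eq_of_approx (hb : IsBComplete b) (hu : IsContracting b u) {S : PowerSeries R}
    {v w : M} (h : ∀ m n₀, ∃ p, AgreeUpTo n₀ p S ∧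
      w - Polynomial.aeval u p v ∈ LinearMap.range (b ^ m)) : opSeries b u S v = w := by
  rw [← sub_eq_zero]
  refine hb.separated _ fun m => ?_
  obtain ⟨n₀, h₀⟩ := opSeries_sub_aeval_mem hb hu S m
  obtain ⟨p, hp, hw⟩ := h m n₀
  have := Submodule.sub_mem _ (h₀ p hp v) hw
  simpa using this

lemma opSeries_stable (hb : IsBComplete b) (hu : IsContracting b u) (S : PowerSeries R) (m : ℕ)
    {v : M} (hv : v ∈ LinearMap.range (b ^ m)) : opSeries b u S v ∈ LinearMap.range (b ^ m) := by
  obtain ⟨n₀, h₀⟩ := opSeries_sub_aeval_mem hb hu S m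
  have := Submodule.add_mem _ (h₀ _ (agreeUpTo_trunc n₀ S) v)
    (hu.aeval_stable (PowerSeries.trunc n₀ S) m hv)
  simpa using this

lemma opSeries_mul (hb : IsBComplete b) (hu : IsContracting b u) (S T : PowerSeries R) :
    opSeries b u (S * T) = opSeries b u S * opSeries b u T := by
  ext v
  refine opSeries_eq_of_approx hb hu fun m n₀ => ?_
  obtain ⟨n₁, h₁⟩ := opSeries_sub_aeval_mem hb hu S m
  obtain ⟨n₂, h₂⟩ := opSeries_sub_aeval_mem hb hu T m
  set n := max n₀ (max n₁ n₂)
  have hS := agreeUpTo_trunc n S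
  have hT := agreeUpTo_trunc n T
  refine ⟨_, (hS.mul hT).mono (le_max_left _ _), ?_⟩
  have e1 := h₁ _ (hS.mono ((le_max_left _ _).trans (le_max_right _ _))) (opSeries b u T v)
  have e2 := hu.aeval_stable (PowerSeries.trunc n S) m
    (h₂ _ (hT.mono ((le_max_right _ _).trans (le_max_right _ _))) v)
  have := Submodule.add_mem _ e1 e2
  rw [map_sub] at this
  simpa [Module.End.mul_apply] using this

lemma opSeries_coe (hb : IsBComplete b) (hu : IsContracting b u) (p : Polynomial R) :
    opSeries b u (p : PowerSeries R) = Polynomial.aeval u p := by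
  ext v
  exact opSeries_eq_of_approx hb hu fun m n₀ =>
    ⟨p, agreeUpTo_coe n₀ p, by rw [sub_self]; exact Submodule.zero_mem _⟩

lemma opSeries_add (hb : IsBComplete b) (hu : IsContracting b u) (S T : PowerSeries R) :
    opSeries b u (S + T) = opSeries b u S + opSeries b u T := by
  ext v
  refine opSeries_eq_of_approx hb hu fun m n₀ => ?_
  obtain ⟨n₁, h₁⟩ := opSeries_sub_aeval_mem hb hu S m
  obtain ⟨n₂, h₂⟩ := opSeries_sub_aeval_mem hb hu T m
  set n := max n₀ (max n₁ n₂)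
  have hS := agreeUpTo_trunc n S
  have hT := agreeUpTo_trunc n T
  refine ⟨_, (hS.add hT).mono (le_max_left _ _), ?_⟩
  have e1 := h₁ _ (hS.mono ((le_max_left _ _).trans (le_max_right _ _))) v
  have e2 := h₂ _ (hT.mono ((le_max_right _ _).trans (le_max_right _ _))) v
  have := Submodule.add_mem _ e1 e2
  rw [map_add, LinearMap.add_apply, LinearMap.add_apply, add_sub_add_comm]
  exact this

lemma opSeries_C (hb : IsBComplete b) (hu : IsContracting b u) (c : R) :
    opSeries b u (PowerSeries.C c) = c • 1 := by
  rw [← Polynomial.coe_C, opSeries_coe hb hu, Polynomial.aeval_C, Algebra.algebraMap_eq_smul_one]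

lemma opSeries_X (hb : IsBComplete b) (hu : IsContracting b u) :
    opSeries b u PowerSeries.X = u := by
  rw [← Polynomial.coe_X, opSeries_coe hb hu, Polynomial.aeval_X]

lemma opSeries_one (hb : IsBComplete b) (hu : IsContracting b u) :
    opSeries b u (1 : PowerSeries R) = 1 := by
  rw [← Polynomial.coe_one, opSeries_coe hb hu, map_one]

lemma opSeries_zero (hb : IsBComplete b) (hu : IsContracting b u) :
    opSeries b u (0 : PowerSeries R) = 0 := by
  rw [← Polynomial.coe_zero, opSeries_coe hb hu, map_zero]

lemma opSeries_C_mul (hb : IsBComplete b) (hu : IsContracting b u) (c : R) (S : PowerSeries R) :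
    opSeries b u (PowerSeries.C c * S) = c • opSeries b u S := by
  rw [opSeries_mul hb hu, opSeries_C hb hu, smul_mul_assoc, one_mul]

lemma opSeries_pow (hb : IsBComplete b) (hu : IsContracting b u) (S : PowerSeries R) (n : ℕ) :
    opSeries b u (S ^ n) = opSeries b u S ^ n := by
  induction n with
  | zero => rw [pow_zero, pow_zero, opSeries_one hb hu]
  | succ n ih => rw [pow_succ, pow_succ, opSeries_mul hb hu, ih]

lemma isContracting_self (b : Module.End R M) : IsContracting b b := by
  refine ⟨?_, 1, ?_⟩
  · rintro m _ ⟨v, rfl⟩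
    exact ⟨b v, by rw [← Module.End.mul_apply, ← Module.End.mul_apply, pow_mul_comm']⟩
  · rintro m _ ⟨v, rfl⟩
    exact ⟨v, by rw [pow_one, pow_succ', Module.End.mul_apply]⟩

/-! ### Semilinear maps that commute with the operators. -/

section Naturality

variable {R' M' : Type*} [CommRing R'] [AddCommGroup M'] [Module R' M'] {σ : R →+* R'}
  {b' u' : Module.End R' M'}

lemma map_pow_apply (J : M →ₛₗ[σ] M') (hJ : ∀ v, J (u v) = u' (J v)) (i : ℕ) (v : M) :
    J ((u ^ i) v) = (u' ^ i) (J v) := by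
  induction i with
  | zero => simp
  | succ i ih => rw [pow_succ', pow_succ', Module.End.mul_apply, Module.End.mul_apply, hJ, ih]

lemma map_mem_range (J : M →ₛₗ[σ] M') (hb : ∀ v, J (b v) = b' (J v)) (m : ℕ) {v : M}
    (hv : v ∈ LinearMap.range (b ^ m)) : J v ∈ LinearMap.range (b' ^ m) := by
  obtain ⟨w, rfl⟩ := hv
  exact ⟨J w, (map_pow_apply J hb m w).symm⟩

/-- Maps that commute with the operators commute with operator series. -/
lemma map_opSeries (hbc : IsBComplete b) (hu : IsContracting b u) (hbc' : IsBComplete b')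
    (hu' : IsContracting b' u') (J : M →ₛₗ[σ] M') (hb : ∀ v, J (b v) = b' (J v))
    (hJ : ∀ v, J (u v) = u' (J v)) (S : PowerSeries R) (v : M) :
    J (opSeries b u S v) = opSeries b' u' (PowerSeries.map σ S) (J v) := by
  refine (opSeries_eq_of_seriesConverges hbc' hu' fun m => ?_).symm
  obtain ⟨n₀, h₀⟩ := opSeries_spec hbc hu S v m
  refine ⟨n₀, fun n hn => ?_⟩
  have := map_mem_range J hb m (h₀ n hn)
  rw [map_sub, map_sum] at this
  simpa only [map_smulₛₗ, map_pow_apply J hJ, PowerSeries.coeff_map] using this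

end Naturality

end OperatorSeries

/-! ### Modules with operators `a`, `b` such that `ab - ba = b²` -/

section ABModules

variable {R M : Type*} [CommRing R] [AddCommGroup M] [Module R M]

/-- A `b`-complete module with `ab - ba = b²` on which `a` is nilpotent modulo `b`. -/
structure IsABModule (a b : Module.End R M) : Prop extends IsBComplete b where
  comm : ∀ v, a (b v) = b (a v) + b (b v)
  nilpotent : ∃ K, ∀ v, (a ^ K) v ∈ LinearMap.range b

variable {a b : Module.End R M}

lemma comm_pow (h : ∀ v, a (b v) = b (a v) + b (b v)) (m : ℕ) (v : M) :
    a ((b ^ m) v) = (b ^ m) (a v + (m : R) • b v) := by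
  induction m generalizing v with
  | zero => simp
  | succ m ih =>
    rw [pow_succ, Module.End.mul_apply, ih, h, Module.End.mul_apply]
    congr 1
    simp only [map_add, map_smul, Nat.cast_add, Nat.cast_one, add_smul, one_smul]
    abel

/-- Modulo b^(m+1) the operators aⁱ and b^m commute, so nilpotency of `a` on M/bM passes to every
graded piece b^m M / b^(m+1) M with the same exponent. -/
lemma IsABModule.isContracting (h : IsABModule a b) : IsContracting b a := by
  have stable : ∀ m v, v ∈ LinearMap.range (b ^ m) → a v ∈ LinearMap.range (b ^ m) := by
    rintro m _ ⟨v, rfl⟩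
    exact ⟨_, (comm_pow h.comm m v).symm⟩
  obtain ⟨K, hK⟩ := h.nilpotent
  refine ⟨stable, K, ?_⟩
  have key : ∀ i m v, ∃ w, (a ^ i) ((b ^ m) v) = (b ^ m) ((a ^ i) v + b w) := by
    intro i m v
    induction i with
    | zero => exact ⟨0, by simp⟩
    | succ i ih =>
      obtain ⟨w, hw⟩ := ih
      refine ⟨a w + b w + (m : R) • ((a ^ i) v + b w), ?_⟩
      rw [pow_succ', Module.End.mul_apply, hw, comm_pow h.comm]
      congr 1
      simp only [map_add, map_smul, h.comm, smul_add, Module.End.mul_apply]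
      abel
  rintro m _ ⟨v, rfl⟩
  obtain ⟨w, hw⟩ := key K m v
  obtain ⟨z, hz⟩ := hK v
  exact ⟨z + w, by rw [hw, ← hz, ← map_add, pow_succ, Module.End.mul_apply]⟩

/-- On monomials this is aⁿb = baⁿ + n b aⁿ⁻¹ b. The last `b` stays on the right of the derivative,
which avoids iterated corrections. -/
lemma aeval_comm (h : ∀ v, a (b v) = b (a v) + b (b v)) (p : Polynomial R) (v : M) :
    Polynomial.aeval a p (b v) = b (Polynomial.aeval a p v)
      + b (Polynomial.aeval a (Polynomial.derivative p) (b v)) := by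
  induction p using Polynomial.induction_on' with
  | add p q hp hq =>
    simp only [map_add, LinearMap.add_apply, hp, hq]
    abel
  | monomial n c =>
    rw [Polynomial.derivative_monomial, Polynomial.aeval_monomial, Polynomial.aeval_monomial]
    simp only [Module.algebraMap_end_eq_smul_id, Module.End.mul_apply, LinearMap.smul_apply,
      LinearMap.id_apply, map_smul, mul_smul]
    rw [← smul_add]
    congr 1
    induction n with
    | zero => simp
    | succ n ih =>
      rcases n with _ | n
      · simp [h]
      · have ih2 := congrArg b ih
        rw [Nat.add_sub_cancel] at ih2 ih
        rw [pow_succ', Module.End.mul_apply, ih, map_add, map_smul, h, h, Nat.add_sub_cancel,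
          ← Module.End.mul_apply a (a ^ (n + 1)), ← Module.End.mul_apply a (a ^ n), ← pow_succ', ← pow_succ' a n,
          Nat.cast_succ (n + 1)]
        simp only [map_add, map_smul] at ih2
        push_cast at ih2 ⊢
        linear_combination (norm := module) -ih2

/-- The commutation rule `S(a) b = b S(a) + b S'(a) b`. -/
lemma IsABModule.opSeries_comm (h : IsABModule a b) (S : PowerSeries R) (v : M) :
    opSeries b a S (b v) = b (opSeries b a S v)
      + b (opSeries b a (PowerSeries.derivative R S) (b v)) := by
  have hb := h.toIsBComplete
  have ha := h.isContracting
  rw [← sub_eq_zero]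
  refine hb.separated _ fun m => ?_
  obtain ⟨n₁, h₁⟩ := opSeries_sub_aeval_mem hb ha S m
  obtain ⟨n₂, h₂⟩ := opSeries_sub_aeval_mem hb ha (PowerSeries.derivative R S) m
  set n := max n₁ n₂
  -- One extra order, because differentiation loses one.
  have hS := agreeUpTo_trunc (n + 1) S
  have e1 := h₁ _ (hS.mono ((le_max_left n₁ n₂).trans n.le_succ))
  have e2 := h₂ _ (hS.derivative.mono (le_max_right n₁ n₂)) (b v)
  have e3 := (isContracting_self b).stable m _ (Submodule.add_mem _ (e1 v) e2)
  have e4 := Submodule.sub_mem _ (e1 (b v)) e3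
  rw [aeval_comm h.comm] at e4
  simp only [map_add, map_sub] at e4
  convert e4 using 1
  abel

lemma aeval_self_comm (h : ∀ v, a (b v) = b (a v) + b (b v)) (p : Polynomial R) (v : M) :
    a (Polynomial.aeval b p v) = Polynomial.aeval b p (a v)
      + b (b (Polynomial.aeval b (Polynomial.derivative p) v)) := by
  induction p using Polynomial.induction_on' with
  | add p q hp hq =>
    simp only [map_add, LinearMap.add_apply, hp, hq]
    abel
  | monomial n c =>
    rw [Polynomial.derivative_monomial, Polynomial.aeval_monomial, Polynomial.aeval_monomial]
    simp only [Module.algebraMap_end_eq_smul_id, Module.End.mul_apply, LinearMap.smul_apply,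
      LinearMap.id_apply, map_smul, mul_smul]
    rw [← smul_add, comm_pow h, map_add, map_smul]
    congr 2
    rcases n with _ | n
    · simp
    · rw [Nat.add_sub_cancel, ← Module.End.mul_apply (b ^ (n + 1)), ← pow_succ, pow_succ', pow_succ',
        Module.End.mul_apply, Module.End.mul_apply]

/-- The commutation rule `a S(b) = S(b) a + b² S'(b)`. -/
lemma IsABModule.comm_opSeries_self (h : IsABModule a b) (S : PowerSeries R) (v : M) :
    a (opSeries b b S v) = opSeries b b S (a v)
      + b (b (opSeries b b (PowerSeries.derivative R S) v)) := by
  have hb := h.toIsBComplete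
  have hs := isContracting_self b
  rw [← sub_eq_zero]
  refine hb.separated _ fun m => ?_
  obtain ⟨n₁, h₁⟩ := opSeries_sub_aeval_mem hb hs S m
  obtain ⟨n₂, h₂⟩ := opSeries_sub_aeval_mem hb hs (PowerSeries.derivative R S) m
  set n := max n₁ n₂
  have hS := agreeUpTo_trunc (n + 1) S
  have e1 := h₁ _ (hS.mono ((le_max_left n₁ n₂).trans n.le_succ))
  have e2 := h₂ _ (hS.derivative.mono (le_max_right n₁ n₂)) v
  have e3 := hs.stable m _ (hs.stable m _ e2)
  have e4 := Submodule.sub_mem _ (Submodule.sub_mem _ (h.isContracting.stable m _ (e1 v))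
    (e1 (a v))) e3
  simp only [map_sub] at e4
  rw [aeval_self_comm h.comm] at e4
  convert e4 using 1
  abel

/-! ### Change of variable -/

/-- `θ(0) = 0` and `θ'(0)` is invertible. -/
structure IsChange (θ : PowerSeries R) : Prop where
  coeff_zero : PowerSeries.coeff 0 θ = 0
  isUnit_coeff_one : IsUnit (PowerSeries.coeff 1 θ)

lemma IsChange.exists_eq_X_mul {θ : PowerSeries R} (hθ : IsChange θ) :
    ∃ η : PowerSeries R, θ = PowerSeries.X * η ∧ IsUnit η := by
  have h0 : PowerSeries.constantCoeff θ = 0 := by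
    rw [← PowerSeries.coeff_zero_eq_constantCoeff_apply, hθ.coeff_zero]
  obtain ⟨η, hη⟩ := PowerSeries.X_dvd_iff.mpr h0
  refine ⟨η, hη, ?_⟩
  rw [PowerSeries.isUnit_iff_constantCoeff, ← PowerSeries.coeff_zero_eq_constantCoeff_apply,
    ← PowerSeries.coeff_succ_X_mul 0 η, ← hη]
  exact hθ.isUnit_coeff_one

lemma IsChange.isUnit_derivative {θ : PowerSeries R} (hθ : IsChange θ) :
    IsUnit (PowerSeries.derivative R θ) := by
  rw [PowerSeries.isUnit_iff_constantCoeff, ← PowerSeries.coeff_zero_eq_constantCoeff_apply,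
    PowerSeries.coeff_derivative]
  simpa using hθ.isUnit_coeff_one

/-- The operator `b θ'(a)`. -/
noncomputable def changedB (a b : Module.End R M) (θ : PowerSeries R) : Module.End R M :=
  b * opSeries b a (PowerSeries.derivative R θ)

variable {θ : PowerSeries R}

lemma opSeries_unit_image (h : IsABModule a b) {S : PowerSeries R} (hS : IsUnit S) (m : ℕ) (v : M)
    (hv : v ∈ LinearMap.range (b ^ m)) :
    ∃ w ∈ LinearMap.range (b ^ m), opSeries b a S w = v := by
  obtain ⟨S, rfl⟩ := hS
  refine ⟨opSeries b a (↑S⁻¹ : PowerSeries R) v,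
    opSeries_stable h.toIsBComplete h.isContracting _ m hv, ?_⟩
  rw [← Module.End.mul_apply, ← opSeries_mul h.toIsBComplete h.isContracting, Units.mul_inv,
    opSeries_one h.toIsBComplete h.isContracting, Module.End.one_apply]

/-- The operator θ'(a) and its inverse are both series in `a`, so each preserves every b^m M;
inserting θ'(a) after `b` does not change the images. Hence the β-adic and `b`-adic topologies
coincide. -/
lemma range_changedB_pow (h : IsABModule a b) (hθ : IsChange θ) (m : ℕ) :
    LinearMap.range (changedB a b θ ^ m) = LinearMap.range (b ^ m) := by
  induction m with
  | zero => rfl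
  | succ m ih =>
    ext v
    rw [pow_succ']
    constructor
    · rintro ⟨w, rfl⟩
      have h1 : (changedB a b θ ^ m) w ∈ LinearMap.range (b ^ m) := ih ▸ ⟨w, rfl⟩
      obtain ⟨z, hz⟩ := opSeries_stable h.toIsBComplete h.isContracting
        (PowerSeries.derivative R θ) m h1
      exact ⟨z, by rw [pow_succ', Module.End.mul_apply, hz]; rfl⟩
    · rintro ⟨w, rfl⟩
      obtain ⟨z, hz, hz'⟩ := opSeries_unit_image h hθ.isUnit_derivative m _
        (⟨w, rfl⟩ : (b ^ m) w ∈ LinearMap.range (b ^ m))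
      rw [← ih] at hz
      obtain ⟨y, rfl⟩ := hz
      refine ⟨y, ?_⟩
      rw [pow_succ', Module.End.mul_apply, Module.End.mul_apply, ← hz']
      rfl

lemma range_changedB (h : IsABModule a b) (hθ : IsChange θ) :
    LinearMap.range (changedB a b θ) = LinearMap.range b := by
  simpa using range_changedB_pow h hθ 1

/-- The module `θ_*(M)` is again a module of the same kind. -/
lemma IsABModule.change (h : IsABModule a b) (hθ : IsChange θ) :
    IsABModule (opSeries b a θ) (changedB a b θ) where
  injective := by
    obtain ⟨S, hS⟩ := hθ.isUnit_derivative
    intro v w hvw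
    have := h.injective hvw
    have := congrArg (opSeries b a (↑S⁻¹ : PowerSeries R)) this
    rwa [← hS, ← Module.End.mul_apply, ← Module.End.mul_apply,
      ← opSeries_mul h.toIsBComplete h.isContracting, Units.inv_mul,
      opSeries_one h.toIsBComplete h.isContracting] at this
  separated v hv := h.separated v fun n => by rw [← range_changedB_pow h hθ]; exact hv n
  complete u hu := by
    simp only [range_changedB_pow h hθ] at hu ⊢
    exact h.complete u hu
  comm v := by
    -- The commutation rule for θ gives αb = bα + bθ'(a)b. Applied to θ'(a)v, and with α commuting
    -- with θ'(a), it yields αβ = βα + β².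
    simp only [changedB, Module.End.mul_apply]
    rw [h.opSeries_comm θ, ← Module.End.mul_apply (opSeries b a θ),
      ← opSeries_mul h.toIsBComplete h.isContracting, mul_comm,
      opSeries_mul h.toIsBComplete h.isContracting, Module.End.mul_apply]
  nilpotent := by
    obtain ⟨K, hK⟩ := h.nilpotent
    -- With θ = Xη, α^K = η(a)^K a^K, and series in `a` preserve the image of `b`.
    obtain ⟨η, hη, -⟩ := hθ.exists_eq_X_mul
    refine ⟨K, fun v => ?_⟩
    have hr : LinearMap.range (b ^ 1) = LinearMap.range b := by rw [pow_one]
    rw [range_changedB h hθ, ← opSeries_pow h.toIsBComplete h.isContracting, hη, mul_comm, mul_pow,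
      opSeries_mul h.toIsBComplete h.isContracting, opSeries_pow h.toIsBComplete h.isContracting
        PowerSeries.X, opSeries_X h.toIsBComplete h.isContracting, Module.End.mul_apply, ← hr]
    exact opSeries_stable h.toIsBComplete h.isContracting _ 1 (hr ▸ hK v)

section Naturality

variable {R' M' : Type*} [CommRing R'] [AddCommGroup M'] [Module R' M'] {σ : R →+* R'}
  {a' b' : Module.End R' M'}

lemma map_derivative (σ : R →+* R') (S : PowerSeries R) :
    PowerSeries.map σ (PowerSeries.derivative R S)
      = PowerSeries.derivative R' (PowerSeries.map σ S) := by
  ext i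
  simp [PowerSeries.coeff_derivative]

lemma map_changedB (h : IsABModule a b) (h' : IsABModule a' b') (J : M →ₛₗ[σ] M')
    (ha : ∀ v, J (a v) = a' (J v)) (hb : ∀ v, J (b v) = b' (J v)) (θ : PowerSeries R) (v : M) :
    J (changedB a b θ v) = changedB a' b' (PowerSeries.map σ θ) (J v) := by
  rw [changedB, changedB, Module.End.mul_apply, Module.End.mul_apply, hb, ← map_derivative,
    map_opSeries h.toIsBComplete h.isContracting h'.toIsBComplete h'.isContracting J hb ha]

end Naturality

lemma IsABModule.of_equiv {M' : Type*} [AddCommGroup M'] [Module R M'] (h : IsABModule a b)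
    {a' b' : Module.End R M'} (e : M ≃ₗ[R] M')
    (ha : ∀ v, e (a v) = a' (e v)) (hb : ∀ v, e (b v) = b' (e v)) : IsABModule a' b' := by
  have hr : ∀ m v, e v ∈ LinearMap.range (b' ^ m) ↔ v ∈ LinearMap.range (b ^ m) := by
    intro m v
    refine ⟨?_, map_mem_range e.toLinearMap hb m⟩
    rintro ⟨w, hw⟩
    refine ⟨e.symm w, e.injective ?_⟩
    rw [← hw]
    have := map_pow_apply e.toLinearMap hb m (e.symm w)
    simpa using this
  refine ⟨⟨?_, ?_, ?_⟩, ?_, ?_⟩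
  · intro v w hvw
    obtain ⟨v, rfl⟩ := e.surjective v
    obtain ⟨w, rfl⟩ := e.surjective w
    rw [← hb, ← hb] at hvw
    rw [h.injective (e.injective hvw)]
  · intro v hv
    obtain ⟨v, rfl⟩ := e.surjective v
    rw [h.separated v fun n => (hr n v).mp (hv n), map_zero]
  · intro u hu
    obtain ⟨w, hw⟩ := h.complete (fun n => e.symm (u n))
      (fun n => by rw [← hr]; simpa using hu n)
    refine ⟨e w, fun n => ?_⟩
    have := (hr n _).mpr (hw n)
    simpa using this
  · intro v
    obtain ⟨v, rfl⟩ := e.surjective v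
    rw [← hb, ← ha, h.comm, map_add, hb, ha, hb, hb]
  · obtain ⟨K, hK⟩ := h.nilpotent
    refine ⟨K, fun v => ?_⟩
    obtain ⟨v, rfl⟩ := e.surjective v
    rw [← show _ = (a' ^ K) (e v) from map_pow_apply e.toLinearMap ha K v]
    obtain ⟨w, hw⟩ := hK v
    exact ⟨e w, by rw [← hb, hw]; rfl⟩

/-! ### Expansions with respect to a basis modulo `b` -/

/-- The map `S ↦ ∑ Sᵢ(b) eᵢ`. -/
noncomputable def expansion {ι : Type*} [Fintype ι] (b : Module.End R M) (e : ι → M)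
    (S : ι → PowerSeries R) : M :=
  ∑ i, opSeries b b (S i) (e i)

section Expansion

variable {ι : Type*} [Fintype ι]

lemma expansion_add (hb : IsBComplete b) (e : ι → M) (S T : ι → PowerSeries R) :
    expansion b e (S + T) = expansion b e S + expansion b e T := by
  simp only [expansion, Pi.add_apply, opSeries_add hb (isContracting_self b), LinearMap.add_apply,
    Finset.sum_add_distrib]

lemma expansion_smul (hb : IsBComplete b) (e : ι → M) (c : R) (S : ι → PowerSeries R) :
    expansion b e (c • S) = c • expansion b e S := by
  simp only [expansion, Pi.smul_apply, PowerSeries.smul_eq_C_mul,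
    opSeries_C_mul hb (isContracting_self b), LinearMap.smul_apply, Finset.smul_sum]

lemma expansion_X_mul (hb : IsBComplete b) (e : ι → M) (S : ι → PowerSeries R) :
    expansion b e (fun i => PowerSeries.X * S i) = b (expansion b e S) := by
  simp only [expansion, opSeries_mul hb (isContracting_self b), opSeries_X hb (isContracting_self b),
    Module.End.mul_apply, map_sum]

lemma expansion_C (hb : IsBComplete b) (e : ι → M) (c : ι → R) :
    expansion b e (fun i => PowerSeries.C (c i)) = ∑ i, c i • e i := by
  simp only [expansion, opSeries_C hb (isContracting_self b), LinearMap.smul_apply,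
    Module.End.one_apply]

/-- Descent: in a relation the constant terms vanish by independence modulo `b`; dividing by X,
which is allowed since `b` is injective, gives another relation, so every coefficient vanishes in
turn. -/
lemma expansion_injective (hb : IsBComplete b) (e : ι → M)
    (he : ∀ c : ι → R, ∑ i, c i • e i ∈ LinearMap.range b → c = 0) (S : ι → PowerSeries R)
    (hS : expansion b e S = 0) : S = 0 := by
  have key : ∀ n, ∀ S : ι → PowerSeries R, expansion b e S = 0 →
      ∀ i, PowerSeries.coeff n (S i) = 0 := by
    have step : ∀ S : ι → PowerSeries R, expansion b e S = 0 →
        ∃ T : ι → PowerSeries R, expansion b e T = 0 ∧ S = fun i => PowerSeries.X * T i := by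
      intro S hS
      set T : ι → PowerSeries R := fun i => PowerSeries.mk fun n => PowerSeries.coeff (n + 1) (S i)
      have h1 : S = (fun i => PowerSeries.X * T i)
          + fun i => PowerSeries.C (PowerSeries.constantCoeff (S i)) := by
        funext i
        exact PowerSeries.eq_X_mul_shift_add_const (S i)
      have h2 : b (expansion b e T)
          + ∑ i, PowerSeries.constantCoeff (S i) • e i = 0 := by
        rw [← expansion_X_mul hb, ← expansion_C hb, ← expansion_add hb, ← h1, hS]
      have h3 := he (fun i => PowerSeries.constantCoeff (S i))
        ⟨-expansion b e T, by rw [map_neg, neg_eq_iff_add_eq_zero]; exact h2⟩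
      have h4 : S = fun i => PowerSeries.X * T i := by
        rw [h1]
        funext i
        simp [congrFun h3 i, T]
      refine ⟨T, hb.injective ?_, h4⟩
      rw [← expansion_X_mul hb, ← h4, hS, map_zero]
    intro n
    induction n with
    | zero =>
      intro S hS i
      obtain ⟨T, -, rfl⟩ := step S hS
      simp
    | succ n ih =>
      intro S hS i
      obtain ⟨T, hT, rfl⟩ := step S hS
      rw [PowerSeries.coeff_succ_X_mul]
      exact ih T hT i
  funext i
  ext n
  exact key n S hS i

/-- Successive approximation: divide v by `b` with remainder in the span of the eᵢ, repeat with the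
quotient, and collect the remainders as coefficients of the series. -/
lemma expansion_surjective (hb : IsBComplete b) (e : ι → M)
    (he : ∀ v, ∃ c : ι → R, v - ∑ i, c i • e i ∈ LinearMap.range b) (v : M) :
    ∃ S : ι → PowerSeries R, expansion b e S = v := by
  choose c r hr using he
  set w : ℕ → M := fun n => r^[n] v with hw
  have hwr : ∀ n, w n = b (w (n + 1)) + ∑ i, c (w n) i • e i := by
    intro n
    simp only [hw, Function.iterate_succ', Function.comp, hr]
    abel
  have key : ∀ n, w 0 = expansion b e (fun i =>
      (PowerSeries.trunc n (PowerSeries.mk fun n => c (w n) i) : PowerSeries R))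
        + (b ^ n) (w n) := by
    intro n
    induction n with
    | zero =>
      simp [expansion, opSeries_zero hb (isContracting_self b)]
    | succ n ih =>
      rw [ih]
      conv_lhs => rw [hwr n]
      rw [map_add, ← Module.End.mul_apply, ← pow_succ, add_comm ((b ^ (n + 1)) _), ← add_assoc]
      congr 1
      have : (fun i => (PowerSeries.trunc (n + 1) (PowerSeries.mk fun n => c (w n) i) :
          PowerSeries R)) = (fun i => (PowerSeries.trunc n (PowerSeries.mk fun n => c (w n) i) :
          PowerSeries R)) + fun i => PowerSeries.X ^ n * PowerSeries.C (c (w n) i) := by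
        funext i
        simp only [PowerSeries.trunc_succ, PowerSeries.coeff_mk, Polynomial.coe_add, Pi.add_apply,
          Polynomial.coe_monomial, PowerSeries.monomial_eq_C_mul_X_pow, mul_comm]
      rw [this, expansion_add hb]
      congr 1
      simp only [expansion, map_sum, map_smul, opSeries_mul hb (isContracting_self b),
        opSeries_C hb (isContracting_self b), opSeries_pow hb (isContracting_self b),
        opSeries_X hb (isContracting_self b), Module.End.mul_apply, LinearMap.smul_apply,
        Module.End.one_apply]
  refine ⟨fun i => PowerSeries.mk fun n => c (w n) i, ?_⟩
  rw [← sub_eq_zero]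
  refine hb.separated _ fun m => ?_
  have h1 : ∀ i, ∃ n₀, ∀ p, AgreeUpTo n₀ p (PowerSeries.mk fun n => c (w n) i) → ∀ v,
      opSeries b b (PowerSeries.mk fun n => c (w n) i) v - Polynomial.aeval b p v
        ∈ LinearMap.range (b ^ m) :=
    fun i => opSeries_sub_aeval_mem hb (isContracting_self b) _ m
  choose n₀ h₀ using h1
  -- Large enough for both errors: n ≥ m puts the remainder b^n w_n in b^m M, and n ≥ n₀ i controls
  -- each truncation.
  set n := m + ∑ i, n₀ i
  have h2 : ∀ i, n₀ i ≤ n := fun i =>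
    (Finset.single_le_sum (fun _ _ => Nat.zero_le _) (Finset.mem_univ i)).trans
      (Nat.le_add_left _ _)
  have h3 : ∑ i, (opSeries b b (PowerSeries.mk fun n => c (w n) i) (e i)
      - Polynomial.aeval b (PowerSeries.trunc n (PowerSeries.mk fun n => c (w n) i)) (e i))
        ∈ LinearMap.range (b ^ m) :=
    Submodule.sum_mem _ fun i _ => h₀ i _ ((agreeUpTo_trunc n _).mono (h2 i)) _
  have h4 : (b ^ n) (w n) ∈ LinearMap.range (b ^ m) :=
    range_pow_antitone b (Nat.le_add_right _ _) ⟨_, rfl⟩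
  have h5 := Submodule.sub_mem _ h3 h4
  have h6 := key n
  simp only [expansion, opSeries_coe hb (isContracting_self b)] at h6
  rw [Finset.sum_sub_distrib, sub_sub, ← h6] at h5
  exact h5

end Expansion

end ABModules

/-! ### Standard modules -/

section Standard

variable {R : Type*} [CommRing R] {n : ℕ}

/-- Multiplication by `b` on `R[[b]]ⁿ`. -/
noncomputable def stdB (R : Type*) [CommRing R] (n : ℕ) : Module.End R (Fin n → PowerSeries R) where
  toFun v := fun j => PowerSeries.X * v j
  map_add' v w := by
    funext j
    simp [mul_add]
  map_smul' c v := by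
    funext j
    simp

/-- The operator on `R[[b]]ⁿ` with matrix `C`, extended by the rule `a S = S a + b² S'`. -/
noncomputable def connA (C : Fin n → Fin n → PowerSeries R) :
    Module.End R (Fin n → PowerSeries R) where
  toFun v := fun j => ∑ l, C j l * v l + PowerSeries.X ^ 2 * PowerSeries.derivative R (v j)
  map_add' v w := by
    funext j
    simp only [Pi.add_apply, mul_add, map_add, Finset.sum_add_distrib]
    abel
  map_smul' c v := by
    funext j
    simp [Finset.smul_sum]

lemma stdB_apply (v : Fin n → PowerSeries R) (j : Fin n) :
    stdB R n v j = PowerSeries.X * v j := rfl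

lemma connA_apply (C : Fin n → Fin n → PowerSeries R) (v : Fin n → PowerSeries R) (j : Fin n) :
    connA C v j = ∑ l, C j l * v l + PowerSeries.X ^ 2 * PowerSeries.derivative R (v j) := rfl

lemma stdB_pow_apply (m : ℕ) (v : Fin n → PowerSeries R) (j : Fin n) :
    (stdB R n ^ m) v j = PowerSeries.X ^ m * v j := by
  induction m with
  | zero => simp
  | succ m ih => rw [pow_succ', Module.End.mul_apply, stdB_apply, ih, pow_succ', mul_assoc]

lemma mem_range_stdB_pow {m : ℕ} {v : Fin n → PowerSeries R} :
    v ∈ LinearMap.range (stdB R n ^ m) ↔ ∀ j, (PowerSeries.X : PowerSeries R) ^ m ∣ v j := by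
  constructor
  · rintro ⟨w, rfl⟩ j
    exact ⟨w j, stdB_pow_apply m w j⟩
  · intro h
    choose w hw using h
    exact ⟨w, funext fun j => by rw [stdB_pow_apply, hw]⟩

lemma mem_range_stdB {v : Fin n → PowerSeries R} :
    v ∈ LinearMap.range (stdB R n) ↔ ∀ j, PowerSeries.constantCoeff (v j) = 0 := by
  have := mem_range_stdB_pow (m := 1) (v := v)
  simpa only [pow_one, PowerSeries.X_dvd_iff] using this

lemma isBComplete_stdB (R : Type*) [CommRing R] (n : ℕ) : IsBComplete (stdB R n) where
  injective v w h := by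
    funext j
    ext i
    have := congrArg (PowerSeries.coeff (i + 1)) (congrFun h j)
    simpa only [stdB_apply, PowerSeries.coeff_succ_X_mul] using this
  separated v hv := by
    funext j
    ext i
    exact PowerSeries.X_pow_dvd_iff.mp (mem_range_stdB_pow.mp (hv (i + 1)) j) i i.lt_succ_self
  complete u hu := by
    refine ⟨fun j => PowerSeries.mk fun i => ∑ l ∈ Finset.range (i + 1),
      PowerSeries.coeff i (u l j), fun m => mem_range_stdB_pow.mpr fun j =>
      PowerSeries.X_pow_dvd_iff.mpr fun i hi => ?_⟩
    have h0 : ∀ l, i < l → PowerSeries.coeff i (u l j) = 0 := fun l hl =>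
      PowerSeries.X_pow_dvd_iff.mp (mem_range_stdB_pow.mp (hu l) j) i hl
    rw [Pi.sub_apply, map_sub, PowerSeries.coeff_mk, Finset.sum_apply, map_sum, sub_eq_zero]
    refine Finset.sum_subset (Finset.range_mono hi) fun l _ hl => h0 l ?_
    simpa [Nat.lt_succ_iff] using hl

lemma opSeries_stdB (S : PowerSeries R) (v : Fin n → PowerSeries R) :
    opSeries (stdB R n) (stdB R n) S v = fun j => S * v j := by
  refine opSeries_eq_of_approx (isBComplete_stdB R n) (isContracting_self _) fun m n₀ => ?_
  refine ⟨PowerSeries.trunc (m + n₀) S, (agreeUpTo_trunc _ S).mono (Nat.le_add_left _ _), ?_⟩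
  have h : ∀ p : Polynomial R, Polynomial.aeval (stdB R n) p v
      = fun j => (p : PowerSeries R) * v j := by
    intro p
    induction p using Polynomial.induction_on' with
    | add p q hp hq =>
      rw [map_add, LinearMap.add_apply, hp, hq]
      funext j
      simp [add_mul]
    | monomial i c =>
      funext j
      rw [Polynomial.aeval_monomial, Module.End.mul_apply, Module.algebraMap_end_apply,
        Pi.smul_apply, stdB_pow_apply, Polynomial.coe_monomial, PowerSeries.monomial_eq_C_mul_X_pow,
        PowerSeries.smul_eq_C_mul, mul_assoc]
  rw [h]
  refine mem_range_stdB_pow.mpr fun j => ?_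
  rw [Pi.sub_apply, ← sub_mul]
  refine Dvd.dvd.mul_right (PowerSeries.X_pow_dvd_iff.mpr fun i hi => ?_) _
  rw [map_sub, PowerSeries.coeff_coe_trunc_of_lt (by omega), sub_self]

lemma connA_comm (C : Fin n → Fin n → PowerSeries R) (v : Fin n → PowerSeries R) :
    connA C (stdB R n v) = stdB R n (connA C v) + stdB R n (stdB R n v) := by
  funext j
  simp only [connA_apply, stdB_apply, Pi.add_apply, Derivation.leibniz, PowerSeries.derivative_X,
    smul_eq_mul, mul_add, Finset.mul_sum, mul_left_comm]
  ring

lemma constantCoeff_connA (C : Fin n → Fin n → PowerSeries R) (v : Fin n → PowerSeries R)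
    (j : Fin n) : PowerSeries.constantCoeff (connA C v j)
      = ∑ l, PowerSeries.constantCoeff (C j l) * PowerSeries.constantCoeff (v l) := by
  simp [connA_apply]

lemma isABModule_connA_of_zero (C : Fin n → Fin n → PowerSeries R)
    (hC : ∀ j l, PowerSeries.constantCoeff (C j l) = 0) : IsABModule (connA C) (stdB R n) :=
  ⟨isBComplete_stdB R n, connA_comm C, 1, fun v => mem_range_stdB.mpr fun j => by
    rw [pow_one, constantCoeff_connA]
    simp [hC]⟩

/-! ### The companion module -/

/-- The matrix of `a` in the basis `φ, aφ, …, a^{k-1}φ` when `a^k φ = b ∑ Sᵢ a^i φ`. -/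
noncomputable def companion {k : ℕ} (S : Fin k → PowerSeries R) (i j : Fin k) : PowerSeries R :=
  if (j : ℕ) + 1 = k then PowerSeries.X * S i else if (i : ℕ) = j + 1 then 1 else 0

/-- The generator of the companion module. -/
noncomputable def companionGen (R : Type*) [CommRing R] (k : ℕ) : Fin k → PowerSeries R :=
  fun j => if (j : ℕ) = 0 then 1 else 0

lemma constantCoeff_companion {k : ℕ} (S : Fin k → PowerSeries R) (i j : Fin k) :
    PowerSeries.constantCoeff (companion S i j) = if (i : ℕ) = j + 1 then 1 else 0 := by
  have := i.2
  unfold companion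
  split_ifs with h1 h2 <;> first | omega | simp

/-- Modulo `b` the last column of the matrix vanishes and `a` becomes the nilpotent shift of the
coordinates: after m steps the constant terms with index below m are zero. -/
lemma isABModule_companion {k : ℕ} (S : Fin k → PowerSeries R) :
    IsABModule (connA (companion S)) (stdB R k) := by
  refine ⟨isBComplete_stdB R k, connA_comm _, k, fun v => mem_range_stdB.mpr fun j => ?_⟩
  have key : ∀ m, ∀ j : Fin k, (j : ℕ) < m →
      PowerSeries.constantCoeff ((connA (companion S) ^ m) v j) = 0 := by
    intro m
    induction m with
    | zero => intro j hj; omega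
    | succ m ih =>
      intro j hj
      rw [pow_succ', Module.End.mul_apply, constantCoeff_connA]
      refine Finset.sum_eq_zero fun l _ => ?_
      rw [constantCoeff_companion]
      split_ifs with h
      · rw [ih l (by omega), mul_zero]
      · rw [zero_mul]
  exact key k j j.2

lemma constantCoeff_companion_pow {k : ℕ} (S : Fin k → PowerSeries R) (m : ℕ) (j : Fin k) :
    PowerSeries.constantCoeff ((connA (companion S) ^ m) (companionGen R k) j)
      = if (j : ℕ) = m then 1 else 0 := by
  induction m generalizing j with
  | zero =>
    rw [pow_zero, Module.End.one_apply, companionGen]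
    split_ifs <;> simp
  | succ m ih =>
    rw [pow_succ', Module.End.mul_apply, constantCoeff_connA]
    simp only [ih, constantCoeff_companion, mul_ite, mul_one, mul_zero]
    split_ifs with h
    · rw [Finset.sum_eq_single ⟨m, by omega⟩]
      · simp [h]
      · intro l _ hl
        rw [if_neg]
        exact fun h' => hl (Fin.ext h')
      · simp
    · refine Finset.sum_eq_zero fun l _ => ?_
      split_ifs with h1 h2
      · omega
      · rfl
      · rfl

/-- Modulo `b` the companion module is R[a]/(a^k) with the generator as 1, so S(a) applied to it is
read off from the coefficients of S below degree k. -/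
lemma constantCoeff_opSeries_companionGen {k : ℕ} (S₀ : Fin k → PowerSeries R) (S : PowerSeries R)
    (j : Fin k) : PowerSeries.constantCoeff
      (opSeries (stdB R k) (connA (companion S₀)) S (companionGen R k) j)
        = PowerSeries.coeff (j : ℕ) S := by
  have h := isABModule_companion S₀
  obtain ⟨n₀, h₀⟩ := opSeries_sub_aeval_mem h.toIsBComplete h.isContracting S 1
  -- The extra k in the order keeps the coefficient of index j < k in the truncation.
  have h1 := h₀ _ ((agreeUpTo_trunc (n₀ + k) S).mono (Nat.le_add_right _ _)) (companionGen R k)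
  rw [pow_one, mem_range_stdB] at h1
  have h2 := h1 j
  rw [Pi.sub_apply, map_sub, sub_eq_zero] at h2
  rw [h2, Polynomial.aeval_eq_sum_range' (n := n₀ + k + 1), LinearMap.sum_apply, Finset.sum_apply,
    map_sum]
  · have h3 : ∀ i, PowerSeries.constantCoeff (((PowerSeries.trunc (n₀ + k) S).coeff i •
        connA (companion S₀) ^ i) (companionGen R k) j)
        = if (j : ℕ) = i then (PowerSeries.trunc (n₀ + k) S).coeff i else 0 := by
      intro i
      rw [LinearMap.smul_apply, Pi.smul_apply, PowerSeries.smul_eq_C_mul, map_mul,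
        constantCoeff_companion_pow]
      simp
    simp only [h3]
    rw [Finset.sum_ite_eq, if_pos (Finset.mem_range.mpr (by omega)), PowerSeries.coeff_trunc,
      if_pos (by omega)]
  · refine lt_of_le_of_lt (Polynomial.natDegree_le_iff_coeff_eq_zero.mpr fun i hi => ?_)
      (Nat.lt_succ_self (n₀ + k))
    rw [PowerSeries.coeff_trunc, if_neg (by omega)]

/-! ### Expansions in standard modules -/

/-- As β and `b` have the same image, the quotient by β is Rⁿ, read by constant terms. The unit
determinant makes `e` a basis there, and this lifts to the complete module. -/
lemma expansion_bijective_of_isUnit_det {β : Module.End R (Fin n → PowerSeries R)}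
    (hβ : IsBComplete β) (hr : LinearMap.range β = LinearMap.range (stdB R n))
    (e : Fin n → Fin n → PowerSeries R)
    (he : IsUnit (Matrix.det (Matrix.of fun i j => PowerSeries.constantCoeff (e i j)))) :
    Function.Bijective (expansion β e) := by
  set G : Matrix (Fin n) (Fin n) R := Matrix.of fun i j => PowerSeries.constantCoeff (e i j)
  have hmem : ∀ v : Fin n → PowerSeries R, ∀ c : Fin n → R,
      v - ∑ i, c i • e i ∈ LinearMap.range β ↔
        (fun j => PowerSeries.constantCoeff (v j)) = Matrix.vecMul c G := by
    intro v c
    rw [hr, mem_range_stdB, funext_iff]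
    refine forall_congr' fun j => ?_
    rw [Pi.sub_apply, map_sub, sub_eq_zero, Finset.sum_apply, map_sum]
    simp [Matrix.vecMul, dotProduct, G, PowerSeries.smul_eq_C_mul]
  constructor
  · intro S T hST
    have h0 : expansion β e (S - T) = 0 := by
      have := expansion_add hβ e (S - T) T
      rw [sub_add_cancel, hST] at this
      simpa using this
    rw [← sub_eq_zero]
    refine expansion_injective hβ e (fun c hc => ?_) _ h0
    have h1 := (hmem 0 c).mp (by rw [zero_sub]; exact Submodule.neg_mem _ hc)
    have h2 : Matrix.vecMul c G = 0 := by
      rw [← h1]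
      funext j
      simp
    have := congrArg (fun w => Matrix.vecMul w G⁻¹) h2
    simpa [Matrix.vecMul_vecMul, Matrix.mul_nonsing_inv G he] using this
  · intro v
    refine expansion_surjective hβ e (fun v => ?_) v
    refine ⟨Matrix.vecMul (fun j => PowerSeries.constantCoeff (v j)) G⁻¹, (hmem _ _).mpr ?_⟩
    rw [Matrix.vecMul_vecMul, Matrix.nonsing_inv_mul G he, Matrix.vecMul_one]

/-- The powers of `α = θ(a)` applied to the generator form a basis of the companion module over
the series in `β = b θ'(a)`. -/
lemma expansion_companion_bijective {k : ℕ} (S₀ : Fin k → PowerSeries R) {θ : PowerSeries R}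
    (hθ : IsChange θ) :
    Function.Bijective (expansion (changedB (connA (companion S₀)) (stdB R k) θ)
      fun i : Fin k => (opSeries (stdB R k) (connA (companion S₀)) θ ^ (i : ℕ))
        (companionGen R k)) := by
  have h := isABModule_companion S₀
  refine expansion_bijective_of_isUnit_det (h.change hθ).toIsBComplete (range_changedB h hθ) _ ?_
  obtain ⟨η, hη, hη'⟩ := hθ.exists_eq_X_mul
  have hG : ∀ i j : Fin k, PowerSeries.constantCoeff
      ((opSeries (stdB R k) (connA (companion S₀)) θ ^ (i : ℕ)) (companionGen R k) j)
        = PowerSeries.coeff (j : ℕ) (PowerSeries.X ^ (i : ℕ) * η ^ (i : ℕ)) := by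
    intro i j
    rw [← opSeries_pow h.toIsBComplete h.isContracting, constantCoeff_opSeries_companionGen, hη,
      mul_pow]
  simp only [hG]
  -- Row i lists the coefficients of Xⁱηⁱ: zero before the diagonal and η(0)ⁱ, a unit, on it.
  rw [Matrix.det_of_isUpperTriangular]
  · refine (Finset.univ.prod_induction _ IsUnit (fun _ _ => IsUnit.mul) isUnit_one fun i _ => ?_)
    rw [Matrix.of_apply, PowerSeries.coeff_X_pow_mul', if_pos le_rfl, Nat.sub_self,
      PowerSeries.coeff_zero_eq_constantCoeff_apply]
    exact (hη'.pow _).map _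
  · intro i j hij
    rw [Matrix.of_apply, PowerSeries.coeff_X_pow_mul', if_neg (not_le.mpr (show (j : ℕ) < i from hij))]

/-! ### Comparison of standard modules with submodules generated by a family. -/

section General

variable {M : Type*} [AddCommGroup M] [Module R M] {a b : Module.End R M}

/-- `expansion` as a linear map. -/
noncomputable def expansionMap {ι : Type*} [Fintype ι] (hb : IsBComplete b) (e : ι → M) :
    (ι → PowerSeries R) →ₗ[R] M where
  toFun := expansion b e
  map_add' := expansion_add hb e
  map_smul' := expansion_smul hb e

lemma expansionMap_apply {ι : Type*} [Fintype ι] (hb : IsBComplete b) (e : ι → M)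
    (S : ι → PowerSeries R) : expansionMap hb e S = expansion b e S := rfl

lemma expansion_stdB (hb : IsBComplete b) (e : Fin n → M) (S : Fin n → PowerSeries R) :
    expansion b e (stdB R n S) = b (expansion b e S) :=
  expansion_X_mul hb e S

/-- The rule aS(b) = S(b)a + b²S'(b) is the Leibniz rule built into `connA`, so only the matrix on
the eₗ has to match. -/
lemma expansion_connA (h : IsABModule a b) (e : Fin n → M) (C : Fin n → Fin n → PowerSeries R)
    (he : ∀ l, a (e l) = ∑ j, opSeries b b (C j l) (e j)) (S : Fin n → PowerSeries R) :
    expansion b e (connA C S) = a (expansion b e S) := by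
  have hb := h.toIsBComplete
  have hs := isContracting_self b
  simp only [expansion, map_sum, h.comm_opSeries_self, he, connA_apply, opSeries_add hb hs,
    LinearMap.add_apply, Finset.sum_add_distrib]
  congr 1
  · rw [Finset.sum_comm]
    refine Finset.sum_congr rfl fun j _ => ?_
    have : opSeries b b (∑ l, C j l * S l) = ∑ l, opSeries b b (C j l * S l) :=
      map_sum (AddMonoidHom.mk' (opSeries b b) (opSeries_add hb hs)) _ _
    rw [this, LinearMap.sum_apply]
    refine Finset.sum_congr rfl fun l _ => ?_
    rw [mul_comm, opSeries_mul hb hs, Module.End.mul_apply]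
  · refine Finset.sum_congr rfl fun j _ => ?_
    rw [opSeries_mul hb hs, opSeries_pow hb hs, opSeries_X hb hs, pow_two, Module.End.mul_apply,
      Module.End.mul_apply]

variable {k : ℕ} {v : M} {S₀ : Fin k → PowerSeries R}

lemma expansion_companion (h : IsABModule a b)
    (hv : (a ^ k) v = b (expansion b (fun i : Fin k => (a ^ (i : ℕ)) v) S₀))
    (S : Fin k → PowerSeries R) :
    expansion b (fun i : Fin k => (a ^ (i : ℕ)) v) (connA (companion S₀) S)
      = a (expansion b (fun i : Fin k => (a ^ (i : ℕ)) v) S) := by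
  have hb := h.toIsBComplete
  have hs := isContracting_self b
  refine expansion_connA h _ _ (fun l => ?_) S
  rw [← Module.End.mul_apply, ← pow_succ']
  by_cases hl : (l : ℕ) + 1 = k
  · simp only [companion, if_pos hl]
    rw [hl, hv, ← expansion_X_mul hb]
    rfl
  · simp only [companion, if_neg hl]
    have := l.2
    rw [Finset.sum_eq_single ⟨l + 1, by omega⟩]
    · simp [opSeries_one hb hs]
    · intro j _ hj
      rw [if_neg, opSeries_zero hb hs, LinearMap.zero_apply]
      exact fun h' => hj (Fin.ext h')
    · simp

lemma expansion_companionGen (hb : IsBComplete b)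
    (hv : (a ^ k) v = b (expansion b (fun i : Fin k => (a ^ (i : ℕ)) v) S₀)) :
    expansion b (fun i : Fin k => (a ^ (i : ℕ)) v) (companionGen R k) = v := by
  have hs := isContracting_self b
  rcases k with _ | k
  -- When k = 0 the relation itself says v = 0.
  · simpa [expansion] using hv.symm
  · rw [expansion, Finset.sum_eq_single 0]
    · simp [companionGen, opSeries_one hb hs]
    · intro j _ hj
      rw [companionGen, if_neg, opSeries_zero hb hs, LinearMap.zero_apply]
      exact fun h' => hj (Fin.ext h')
    · simp

end General

/-! ### Base change -/

section BaseChange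

variable {R' : Type*} [CommRing R'] (σ : R →+* R')

/-- Base change of vectors of power series. -/
noncomputable def mapVec (n : ℕ) : (Fin n → PowerSeries R) →ₛₗ[σ] (Fin n → PowerSeries R') where
  toFun v := fun j => PowerSeries.map σ (v j)
  map_add' v w := by
    funext j
    simp
  map_smul' c v := by
    funext j
    simp [PowerSeries.smul_eq_C_mul]

lemma mapVec_apply (v : Fin n → PowerSeries R) (j : Fin n) :
    mapVec σ n v j = PowerSeries.map σ (v j) := rfl

lemma mapVec_stdB (v : Fin n → PowerSeries R) :
    mapVec σ n (stdB R n v) = stdB R' n (mapVec σ n v) := by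
  funext j
  simp [mapVec_apply, stdB_apply]

lemma mapVec_connA (C : Fin n → Fin n → PowerSeries R) (v : Fin n → PowerSeries R) :
    mapVec σ n (connA C v) = connA (fun i j => PowerSeries.map σ (C i j)) (mapVec σ n v) := by
  funext j
  simp [mapVec_apply, connA_apply, map_derivative]

lemma map_companion {k : ℕ} (S : Fin k → PowerSeries R) (i j : Fin k) :
    PowerSeries.map σ (companion S i j) = companion (mapVec σ k S) i j := by
  unfold companion
  split_ifs <;> simp [mapVec_apply]

lemma mapVec_companionGen (k : ℕ) : mapVec σ k (companionGen R k) = companionGen R' k := by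
  funext j
  rw [mapVec_apply, companionGen, companionGen]
  split_ifs <;> simp

lemma map_expansion {M M' : Type*} [AddCommGroup M] [Module R M] [AddCommGroup M'] [Module R' M']
    {β : Module.End R M} {β' : Module.End R' M'} (hb : IsBComplete β) (hb' : IsBComplete β')
    (J : M →ₛₗ[σ] M') (hJ : ∀ v, J (β v) = β' (J v)) {ι : Type*} [Fintype ι] (e : ι → M)
    (S : ι → PowerSeries R) :
    J (expansion β e S) = expansion β' (fun i => J (e i)) (fun i => PowerSeries.map σ (S i)) := by
  simp only [expansion, map_sum]
  exact Finset.sum_congr rfl fun i _ => map_opSeries hb (isContracting_self _) hb'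
    (isContracting_self _) J hJ hJ _ _

end BaseChange

end Standard

/-! ### Linear differential equations for power series -/

section ODE

variable {R : Type*} [CommRing R] [Algebra ℚ R]

/-- The coefficients of the solution of `y' = p y + q` with `y(0) = c`. -/
noncomputable def odeCoeff (p q : PowerSeries R) (c : R) : ℕ → R
  | 0 => c
  | n + 1 => algebraMap ℚ R (1 / (n + 1)) * (∑ i : Fin (n + 1),
      PowerSeries.coeff (n - i) p * odeCoeff p q c i + PowerSeries.coeff n q)

/-- The recursion on coefficients divides by n + 1; this is where rational scalars are needed. -/
lemma exists_ode_solution (p q : PowerSeries R) (c : R) :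
    ∃ y : PowerSeries R, PowerSeries.derivative R y = p * y + q ∧
      PowerSeries.constantCoeff y = c := by
  refine ⟨PowerSeries.mk (odeCoeff p q c), ?_, ?_⟩
  · ext n
    have h : algebraMap ℚ R (1 / (n + 1)) * ((n : R) + 1) = 1 := by
      have h1 : ((n : R) + 1) = algebraMap ℚ R (n + 1) := by simp
      rw [h1, ← map_mul, one_div_mul_cancel (by positivity), map_one]
    rw [PowerSeries.coeff_derivative, PowerSeries.coeff_mk, odeCoeff, mul_right_comm, h, one_mul,
      map_add, mul_comm p, PowerSeries.coeff_mul,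
      Finset.Nat.sum_antidiagonal_eq_sum_range_succ_mk, Finset.sum_range]
    simp [mul_comm]
  · rw [← PowerSeries.coeff_zero_eq_constantCoeff_apply, PowerSeries.coeff_mk, odeCoeff]

end ODE

/-! ### The structure of `Ξ` after a change of variable -/

section Xi

variable {R : Type*} [CommRing R] {N : ℕ}

/-- The matrix of `a` on `Ξ_λ`. -/
noncomputable def xiMatrix (μ : R) (N : ℕ) (j l : Fin N) : PowerSeries R :=
  (if l = j then PowerSeries.C μ * PowerSeries.X else 0)
    + if (l : ℕ) = j + 1 then PowerSeries.X else 0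

lemma isABModule_xiMatrix (μ : R) (N : ℕ) : IsABModule (connA (xiMatrix μ N)) (stdB R N) := by
  refine isABModule_connA_of_zero _ fun j l => ?_
  unfold xiMatrix
  split_ifs <;> simp

lemma map_xiMatrix {R' : Type*} [CommRing R'] (σ : R →+* R') (μ : R) (j l : Fin N) :
    PowerSeries.map σ (xiMatrix μ N j l) = xiMatrix (σ μ) N j l := by
  unfold xiMatrix
  split_ifs <;> simp

/-- The shift `e_j ↦ e_{j-1}` of `Ξ_λ`. -/
noncomputable def shift (R : Type*) [CommRing R] (N : ℕ) : Module.End R (Fin N → PowerSeries R) where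
  toFun v := fun j => if h : (j : ℕ) + 1 < N then v ⟨j + 1, h⟩ else 0
  map_add' v w := by
    funext j
    simp only [Pi.add_apply]
    split_ifs <;> simp
  map_smul' c v := by
    funext j
    simp only [Pi.smul_apply, RingHom.id_apply]
    split_ifs <;> simp

lemma shift_pow_eq_zero (v : Fin N → PowerSeries R) : (shift R N ^ N) v = 0 := by
  have key : ∀ m, ∀ j : Fin N, N ≤ j + m → (shift R N ^ m) v j = 0 := by
    intro m
    induction m with
    | zero => intro j hj; omega
    | succ m ih =>
      intro j hj
      rw [pow_succ', Module.End.mul_apply]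
      change (if h : (j : ℕ) + 1 < N then (shift R N ^ m) v ⟨j + 1, h⟩ else 0) = 0
      split_ifs with h
      · exact ih _ (by simp only; omega)
      · rfl
  funext j
  exact key N j (by omega)

lemma connA_xiMatrix_apply (μ : R) (v : Fin N → PowerSeries R) (j : Fin N) :
    connA (xiMatrix μ N) v j = μ • (PowerSeries.X * v j) + PowerSeries.X * shift R N v j
      + PowerSeries.X ^ 2 * PowerSeries.derivative R (v j) := by
  rw [connA_apply]
  congr 1
  simp only [xiMatrix, add_mul, ite_mul, zero_mul, Finset.sum_add_distrib, Finset.sum_ite_eq',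
    Finset.mem_univ, if_true]
  congr 1
  · rw [PowerSeries.smul_eq_C_mul, mul_assoc]
  · change _ = PowerSeries.X * (if h : (j : ℕ) + 1 < N then v ⟨j + 1, h⟩ else 0)
    split_ifs with h
    · rw [Finset.sum_eq_single ⟨j + 1, h⟩]
      · simp
      · intro l _ hl
        exact if_neg fun h' => hl (Fin.ext h')
      · simp
    · rw [mul_zero]
      refine Finset.sum_eq_zero fun l _ => if_neg fun h' => h ?_
      have := l.2
      omega

lemma xiA_eq_connA (lam : ℚ) (N : ℕ) : xiA lam N = connA (xiMatrix (lam : ℂ) N) := by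
  refine LinearMap.ext fun v => funext fun j => ?_
  rw [connA_xiMatrix_apply]
  change (lam : ℂ) • (PowerSeries.X * v j)
    + (if h : (j : ℕ) + 1 < N then PowerSeries.X * v ⟨(j : ℕ) + 1, h⟩ else 0)
    + PowerSeries.X ^ 2 * PowerSeries.derivative ℂ (v j) = _ + PowerSeries.X *
      (if h : (j : ℕ) + 1 < N then v ⟨j + 1, h⟩ else 0) + _
  split_ifs <;> simp

/-- Vectors with constant entries. -/
def IsConst (v : Fin N → PowerSeries R) : Prop := ∀ j, PowerSeries.derivative R (v j) = 0

lemma connA_xiMatrix_of_isConst (μ : R) {v : Fin N → PowerSeries R} (hv : IsConst v) :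
    connA (xiMatrix μ N) v = stdB R N (μ • v + shift R N v) := by
  funext j
  rw [connA_xiMatrix_apply, hv j, stdB_apply, Pi.add_apply, Pi.smul_apply, mul_add, mul_zero,
    add_zero, mul_smul_comm]

lemma IsConst.shift {v : Fin N → PowerSeries R} (hv : IsConst v) : IsConst (shift R N v) := by
  intro j
  change PowerSeries.derivative R (if h : (j : ℕ) + 1 < N then v ⟨j + 1, h⟩ else 0) = 0
  split_ifs
  · exact hv _
  · exact map_zero _

/-- Write (XS)(a)x = S(a)by, move `b` to the left by the commutation rule, and replace the remaining
by with ax. -/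
lemma opSeries_X_mul_of_eq {M : Type*} [AddCommGroup M] [Module R M] {a b : Module.End R M}
    (h : IsABModule a b) {x y : M} (hxy : a x = b y) (S : PowerSeries R) :
    opSeries b a (PowerSeries.X * S) x = b (opSeries b a S y
      + opSeries b a (PowerSeries.X * PowerSeries.derivative R S) x) := by
  have hb := h.toIsBComplete
  have ha := h.isContracting
  rw [mul_comm, opSeries_mul hb ha, opSeries_X hb ha, Module.End.mul_apply, hxy, h.opSeries_comm,
    ← hxy, mul_comm, opSeries_mul hb ha (PowerSeries.derivative R S), opSeries_X hb ha,
    Module.End.mul_apply, map_add]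

/-- With u = η/η(0), the series wᵢ stand for u^{μ-1}(log u)ⁱ/i!, defined by their differential
equations so that no power or logarithm of a series is needed. The Gᵢ are the correction terms that
telescope when α is applied to the new basis. -/
lemma exists_log_series [Algebra ℚ R] (μ : R) (η : (PowerSeries R)ˣ) :
    ∃ w G : ℕ → PowerSeries R, PowerSeries.constantCoeff (w 0) = 1 ∧
      (∀ i, PowerSeries.constantCoeff (w (i + 1)) = 0) ∧ G 0 = 0 ∧
      (∀ i, G (i + 1) = PowerSeries.X * PowerSeries.derivative R (η : PowerSeries R) * w i) ∧
      ∀ i, PowerSeries.X * PowerSeries.derivative R ((η : PowerSeries R) * w i)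
        = PowerSeries.C μ * G (i + 1) + G i := by
  set g : PowerSeries R := PowerSeries.derivative R (η : PowerSeries R) * (↑η⁻¹ : PowerSeries R)
  have hg : (η : PowerSeries R) * g = PowerSeries.derivative R (η : PowerSeries R) := by
    rw [mul_comm, mul_assoc, Units.inv_mul, mul_one]
  choose sol hsol hsol0 using exists_ode_solution (R := R)
  let w : ℕ → PowerSeries R := fun i => Nat.rec (sol (PowerSeries.C (μ - 1) * g) 0 1)
    (fun _ y => sol (PowerSeries.C (μ - 1) * g) (g * y) 0) i
  have hw0 : PowerSeries.derivative R (w 0) = PowerSeries.C (μ - 1) * g * w 0 + 0 := hsol _ _ _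
  have hw1 : ∀ i, PowerSeries.derivative R (w (i + 1))
      = PowerSeries.C (μ - 1) * g * w (i + 1) + g * w i := fun i => hsol _ _ _
  refine ⟨w, fun i => Nat.rec 0 (fun i _ => PowerSeries.X *
    (PowerSeries.derivative R (η : PowerSeries R)) * w i) i, hsol0 _ _ _, fun i => hsol0 _ _ _, rfl,
    fun i => rfl, fun i => ?_⟩
  rw [Derivation.leibniz, smul_eq_mul, smul_eq_mul]
  rcases i with _ | i
  · change _ = PowerSeries.C μ *
      (PowerSeries.X * PowerSeries.derivative R (η : PowerSeries R) * w 0) + 0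
    rw [hw0, map_sub, map_one]
    linear_combination (PowerSeries.X * (PowerSeries.C μ - 1) * w 0) * hg
  · rw [hw1, map_sub, map_one]
    linear_combination (PowerSeries.X * ((PowerSeries.C μ - 1) * w (i + 1) + w i)) * hg

/-- Such an `a` maps into the image of `b`, so modulo `b` only the constant term of S acts. -/
lemma constantCoeff_opSeries_connA {C : Fin N → Fin N → PowerSeries R}
    (hC : ∀ j l, PowerSeries.constantCoeff (C j l) = 0) (S : PowerSeries R)
    (v : Fin N → PowerSeries R) (j : Fin N) :
    PowerSeries.constantCoeff (opSeries (stdB R N) (connA C) S v j)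
      = PowerSeries.constantCoeff S * PowerSeries.constantCoeff (v j) := by
  have h := isABModule_connA_of_zero C hC
  have hb := h.toIsBComplete
  have ha := h.isContracting
  have h0 : ∀ v, connA C v ∈ LinearMap.range (stdB R N ^ 1) := fun v => by
    rw [pow_one, mem_range_stdB]
    intro j
    rw [constantCoeff_connA]
    simp [hC]
  have h1 := opSeries_stable hb ha (PowerSeries.mk fun p => PowerSeries.coeff (p + 1) S) 1 (h0 v)
  rw [pow_one, mem_range_stdB] at h1
  conv_lhs => rw [PowerSeries.eq_shift_mul_X_add_const S]
  rw [opSeries_add hb ha, opSeries_mul hb ha, opSeries_X hb ha, opSeries_C hb ha,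
    LinearMap.add_apply, Module.End.mul_apply, Pi.add_apply, map_add, h1 j, zero_add,
    LinearMap.smul_apply, Module.End.one_apply, Pi.smul_apply, PowerSeries.smul_eq_C_mul, map_mul,
    PowerSeries.constantCoeff_C]

/-- `Ξ_λ`, with the operators `α = θ(a)` and `β = b θ'(a)`, has a family `e'` on which `α` acts by
the same matrix, and which is congruent to the standard basis modulo `b`. -/
theorem exists_xi_family [Algebra ℚ R] (μ : R) (N : ℕ) {θ : PowerSeries R} (hθ : IsChange θ) :
    ∃ e : Fin N → Fin N → PowerSeries R,
      (∀ l, opSeries (stdB R N) (connA (xiMatrix μ N)) θ (e l)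
        = ∑ j, opSeries (changedB (connA (xiMatrix μ N)) (stdB R N) θ)
            (changedB (connA (xiMatrix μ N)) (stdB R N) θ) (xiMatrix μ N j l) (e j)) ∧
      ∀ l j, PowerSeries.constantCoeff (e l j) = if l = j then 1 else 0 := by
  obtain ⟨η, hη, η, rfl⟩ := hθ.exists_eq_X_mul
  have h := isABModule_xiMatrix μ N
  set a := connA (xiMatrix μ N)
  set b := stdB R N
  have hb := h.toIsBComplete
  have ha := h.isContracting
  obtain ⟨w, G, hc0, hc1, hG0, hG1, hG⟩ := exists_log_series μ η
  let W : Module.End R (Fin N → PowerSeries R) :=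
    ∑ i ∈ Finset.range N, opSeries b a (w i) * shift R N ^ i
  have hW : ∀ x, W x = ∑ i ∈ Finset.range N, opSeries b a (w i) ((shift R N ^ i) x) := by
    intro x
    rw [LinearMap.sum_apply]
    rfl
  have hconst : ∀ i l, IsConst ((shift R N ^ i) (Pi.single l 1)) := by
    intro i l
    induction i with
    | zero =>
      intro j
      rcases eq_or_ne j l with rfl | hj
      · simp
      · simp [hj]
    | succ i ih =>
      rw [pow_succ', Module.End.mul_apply]
      exact ih.shift
  have hθ' : PowerSeries.derivative R θ
      = (η : PowerSeries R) + PowerSeries.X * PowerSeries.derivative R (η : PowerSeries R) := by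
    rw [hη, Derivation.leibniz, PowerSeries.derivative_X, smul_eq_mul, smul_eq_mul, mul_one,
      add_comm]
  have main : ∀ l, opSeries b a θ (W (Pi.single l 1))
      = changedB a b θ (μ • W (Pi.single l 1) + W (shift R N (Pi.single l 1))) := by
    intro l
    set x : ℕ → Fin N → PowerSeries R := fun i => (shift R N ^ i) (Pi.single l 1) with hx
    have hx1 : ∀ i, shift R N (x i) = x (i + 1) := fun i => by
      simp only [hx, pow_succ', Module.End.mul_apply]
    have hx2 : ∀ i, (shift R N ^ i) (shift R N (Pi.single l 1)) = x (i + 1) := fun i => by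
      simp only [hx, pow_succ, Module.End.mul_apply]
    have hxN : x N = 0 := shift_pow_eq_zero _
    -- Here θwᵢ = X(ηwᵢ) and θ'wᵢ = ηwᵢ + G_{i+1}. The terms μG_{i+1} cancel by the differential
    -- equation, which leaves a difference of consecutive terms.
    have step : ∀ i, opSeries b a θ (opSeries b a (w i) (x i))
        = b (opSeries b a (PowerSeries.derivative R θ) (μ • opSeries b a (w i) (x i)
          + opSeries b a (w i) (x (i + 1)))
          + (opSeries b a (G i) (x i) - opSeries b a (G (i + 1)) (x (i + 1)))) := by
      intro i
      have e1 : a (x i) = b (μ • x i + x (i + 1)) := by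
        rw [← hx1]
        exact connA_xiMatrix_of_isConst μ (hconst i l)
      have e2 : ∀ z, opSeries b a (PowerSeries.derivative R θ) (opSeries b a (w i) z)
          = opSeries b a ((η : PowerSeries R) * w i) z + opSeries b a (G (i + 1)) z := fun z => by
        rw [← Module.End.mul_apply, ← opSeries_mul hb ha, hθ', add_mul, ← hG1, opSeries_add hb ha,
          LinearMap.add_apply]
      rw [← Module.End.mul_apply, ← opSeries_mul hb ha, hη, mul_assoc,
        opSeries_X_mul_of_eq h e1, ← hη, hG, opSeries_add hb ha, opSeries_C_mul hb ha]
      simp only [map_add, map_smul, e2, LinearMap.add_apply, LinearMap.smul_apply, map_sub]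
      module
    have hx0 : W (Pi.single l 1) = ∑ i ∈ Finset.range N, opSeries b a (w i) (x i) := hW _
    have hx3 : W (shift R N (Pi.single l 1))
        = ∑ i ∈ Finset.range N, opSeries b a (w i) (x (i + 1)) := by
      rw [hW]
      simp only [hx2]
    rw [hx0, hx3, map_sum]
    simp only [step]
    -- The corrections telescope to zero because G₀ = 0 at one end and the shift is nilpotent (x_N =
    -- 0) at the other.
    rw [← map_sum, Finset.sum_add_distrib, Finset.sum_range_sub', hxN, hG0, opSeries_zero hb ha,
      map_zero, LinearMap.zero_apply, sub_zero, add_zero, ← map_sum, Finset.sum_add_distrib,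
      Finset.smul_sum]
    rfl
  have hβ := (h.change hθ).toIsBComplete
  have hs := isContracting_self (changedB a b θ)
  refine ⟨fun l => W (Pi.single l 1), fun l => ?_, fun l j => ?_⟩
  · rw [main, map_add, map_smul]
    simp only [xiMatrix, opSeries_add hβ hs, LinearMap.add_apply, Finset.sum_add_distrib]
    congr 1
    · rw [Finset.sum_eq_single l]
      · rw [if_pos rfl, opSeries_C_mul hβ hs, opSeries_X hβ hs, LinearMap.smul_apply]
      · intro j _ hj
        rw [if_neg hj.symm, opSeries_zero hβ hs, LinearMap.zero_apply]
      · simp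
    · have e1 : shift R N (Pi.single l 1)
          = ∑ j : Fin N, if (l : ℕ) = j + 1 then Pi.single j 1 else 0 := by
        funext i
        change (if h : (i : ℕ) + 1 < N then (Pi.single l 1 : Fin N → PowerSeries R) ⟨i + 1, h⟩
          else 0) = _
        rw [Finset.sum_apply, Finset.sum_eq_single i]
        · have := l.2
          split_ifs with h1 h2 h2
          · rw [show (⟨i + 1, h1⟩ : Fin N) = l from Fin.ext h2.symm, Pi.single_eq_same,
              Pi.single_eq_same]
          · rw [Pi.single_eq_of_ne, Pi.zero_apply]
            exact fun h' => h2 (by rw [← h'])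
          · omega
          · rfl
        · intro j _ hj
          split_ifs
          · exact Pi.single_eq_of_ne hj.symm _
          · rfl
        · simp
      rw [e1, map_sum, map_sum]
      refine Finset.sum_congr rfl fun j _ => ?_
      split_ifs
      · rw [opSeries_X hβ hs]
      · rw [map_zero, map_zero, opSeries_zero hβ hs, LinearMap.zero_apply]
  · have hC : ∀ j l, PowerSeries.constantCoeff (xiMatrix μ N j l) = 0 := by
      intro j l
      unfold xiMatrix
      split_ifs <;> simp
    have e1 : ∀ i, PowerSeries.constantCoeff
        (opSeries b a (w i) ((shift R N ^ i) (Pi.single l 1)) j)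
          = PowerSeries.constantCoeff (w i) *
            PowerSeries.constantCoeff ((shift R N ^ i) (Pi.single l 1) j) :=
      fun i => constantCoeff_opSeries_connA hC _ _ _
    change PowerSeries.constantCoeff (W (Pi.single l 1) j) = _
    -- Modulo `b` only the term i = 0 survives, since w₀(0) = 1 and wᵢ(0) = 0 for i > 0.
    rw [hW, Finset.sum_apply, map_sum,
      Finset.sum_eq_single_of_mem 0 (Finset.mem_range.mpr (Nat.zero_lt_of_lt l.2)), e1, hc0, one_mul,
      pow_zero, Module.End.one_apply]
    swap
    · intro i _ hi
      obtain ⟨i, rfl⟩ := Nat.exists_eq_succ_of_ne_zero hi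
      rw [e1, hc1, zero_mul]
    rw [Pi.single_apply]
    rcases eq_or_ne l j with rfl | hj
    · simp
    · simp [hj, hj.symm]

end Xi

/-! ### Maps from companion modules -/

section CompanionMap

variable {R R' M : Type*} [CommRing R] [CommRing R'] [AddCommGroup M] [Module R' M]
  {σ : R →+* R'} {a b : Module.End R' M} {k : ℕ}

/-- The map `S ↦ ∑ σ(Sᵢ)(b) aⁱ v` from a companion module. -/
noncomputable def companionMap (σ : R →+* R') (hb : IsBComplete b) (a : Module.End R' M) (k : ℕ)
    (v : M) : (Fin k → PowerSeries R) →ₛₗ[σ] M :=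
  (expansionMap hb fun i : Fin k => (a ^ (i : ℕ)) v).comp (mapVec σ k)

lemma companionMap_apply (hb : IsBComplete b) (v : M) (s : Fin k → PowerSeries R) :
    companionMap σ hb a k v s
      = expansion b (fun i : Fin k => (a ^ (i : ℕ)) v) (fun i => PowerSeries.map σ (s i)) := rfl

lemma companionMap_stdB (hb : IsBComplete b) (v : M) (s : Fin k → PowerSeries R) :
    companionMap σ hb a k v (stdB R k s) = b (companionMap σ hb a k v s) := by
  rw [companionMap, LinearMap.comp_apply, mapVec_stdB, expansionMap_apply, expansion_stdB hb]
  rfl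

lemma IsChange.map {θ : PowerSeries R} (hθ : IsChange θ) (σ : R →+* R') :
    IsChange (PowerSeries.map σ θ) := by
  refine ⟨?_, ?_⟩
  · rw [PowerSeries.coeff_map, hθ.coeff_zero, map_zero]
  · rw [PowerSeries.coeff_map]
    exact hθ.isUnit_coeff_one.map σ

section Relation

variable (h : IsABModule a b) {v : M} {S₀ : Fin k → PowerSeries R}
  (hv : (a ^ k) v = b (companionMap σ h.toIsBComplete a k v S₀))

include hv

lemma companionMap_connA (s : Fin k → PowerSeries R) :
    companionMap σ h.toIsBComplete a k v (connA (companion S₀) s)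
      = a (companionMap σ h.toIsBComplete a k v s) := by
  rw [companionMap, LinearMap.comp_apply, mapVec_connA]
  simp only [map_companion]
  exact expansion_companion h hv _

lemma companionMap_gen :
    companionMap σ h.toIsBComplete a k v (companionGen R k) = v := by
  rw [companionMap, LinearMap.comp_apply, mapVec_companionGen]
  exact expansion_companionGen h.toIsBComplete hv

lemma companionMap_opSeries (S : PowerSeries R) (s : Fin k → PowerSeries R) :
    companionMap σ h.toIsBComplete a k v (opSeries (stdB R k) (connA (companion S₀)) S s)
      = opSeries b a (PowerSeries.map σ S) (companionMap σ h.toIsBComplete a k v s) :=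
  map_opSeries (isBComplete_stdB R k) (isABModule_companion S₀).isContracting h.toIsBComplete
    h.isContracting _ (companionMap_stdB _ _) (companionMap_connA h hv) _ _

lemma companionMap_changedB (θ : PowerSeries R) (s : Fin k → PowerSeries R) :
    companionMap σ h.toIsBComplete a k v (changedB (connA (companion S₀)) (stdB R k) θ s)
      = changedB a b (PowerSeries.map σ θ) (companionMap σ h.toIsBComplete a k v s) :=
  map_changedB (isABModule_companion S₀) h _ (companionMap_connA h hv) (companionMap_stdB _ _) _ _

lemma companionMap_change_pow_gen (θ : PowerSeries R) (i : ℕ) :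
    companionMap σ h.toIsBComplete a k v
        ((opSeries (stdB R k) (connA (companion S₀)) θ ^ i) (companionGen R k))
      = (opSeries b a (PowerSeries.map σ θ) ^ i) v := by
  rw [map_pow_apply _ (companionMap_opSeries h hv θ), companionMap_gen h hv]

lemma companionMap_opSeries_changedB {θ : PowerSeries R} (hθ : IsChange θ) (S : PowerSeries R)
    (s : Fin k → PowerSeries R) :
    companionMap σ h.toIsBComplete a k v
        (opSeries (changedB (connA (companion S₀)) (stdB R k) θ)
          (changedB (connA (companion S₀)) (stdB R k) θ) S s)
      = opSeries (changedB a b (PowerSeries.map σ θ)) (changedB a b (PowerSeries.map σ θ))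
          (PowerSeries.map σ S) (companionMap σ h.toIsBComplete a k v s) :=
  map_opSeries ((isABModule_companion S₀).change hθ).toIsBComplete (isContracting_self _)
    (h.change (hθ.map σ)).toIsBComplete (isContracting_self _) _ (companionMap_changedB h hv θ)
    (companionMap_changedB h hv θ) _ _

lemma companionMap_expansion {θ : PowerSeries R} (hθ : IsChange θ) (S : Fin k → PowerSeries R) :
    companionMap σ h.toIsBComplete a k v
        (expansion (changedB (connA (companion S₀)) (stdB R k) θ)
          (fun i : Fin k => (opSeries (stdB R k) (connA (companion S₀)) θ ^ (i : ℕ))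
            (companionGen R k)) S)
      = expansion (changedB a b (PowerSeries.map σ θ))
          (fun i : Fin k => (opSeries b a (PowerSeries.map σ θ) ^ (i : ℕ)) v)
          (fun i => PowerSeries.map σ (S i)) := by
  simp only [expansion, map_sum, companionMap_opSeries_changedB h hv hθ,
    companionMap_change_pow_gen h hv]

end Relation

/-- The series X^k η^k has no coefficient in degree below k, so α^k of the generator vanishes modulo
`b`, and β has the same image as `b`. -/
lemma change_pow_gen_mem_range (S₀ : Fin k → PowerSeries R) {θ : PowerSeries R} (hθ : IsChange θ) :
    ∃ z, (opSeries (stdB R k) (connA (companion S₀)) θ ^ k) (companionGen R k)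
      = changedB (connA (companion S₀)) (stdB R k) θ z := by
  have h := isABModule_companion S₀
  obtain ⟨η, hη, -⟩ := hθ.exists_eq_X_mul
  have : (opSeries (stdB R k) (connA (companion S₀)) θ ^ k) (companionGen R k)
      ∈ LinearMap.range (changedB (connA (companion S₀)) (stdB R k) θ) := by
    rw [range_changedB h hθ, mem_range_stdB]
    intro j
    rw [← opSeries_pow h.toIsBComplete h.isContracting, constantCoeff_opSeries_companionGen, hη,
      mul_pow, PowerSeries.coeff_X_pow_mul', if_neg (not_le.mpr j.2)]
  obtain ⟨z, hz⟩ := this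
  exact ⟨z, hz.symm⟩

lemma isChange_X (R : Type*) [CommRing R] : IsChange (PowerSeries.X : PowerSeries R) :=
  ⟨by simp, by simp⟩

lemma changedB_X {M : Type*} [AddCommGroup M] [Module R M] {a b : Module.End R M}
    (h : IsABModule a b) : changedB a b PowerSeries.X = b := by
  rw [changedB, PowerSeries.derivative_X, opSeries_one h.toIsBComplete h.isContracting, mul_one]

end CompanionMap

/-! ### Fibres -/

section Fibre

variable {M : Type*} [AddCommGroup M] [Module ℂ M] {a b : Module.End ℂ M} {k : ℕ} {v : M}
  {S₀ : Fin k → PowerSeries ℂ} {θ : PowerSeries ℂ}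

/-- The β-expansion on M is the bijective β-expansion of the companion module followed by the
injective map to M. -/
lemma expansion_change_injective (h : IsABModule a b)
    (hv : (a ^ k) v = b (expansion b (fun i : Fin k => (a ^ (i : ℕ)) v) S₀))
    (hinj : Function.Injective (expansion b fun i : Fin k => (a ^ (i : ℕ)) v)) (hθ : IsChange θ) :
    Function.Injective
      (expansion (changeB a b θ) fun i : Fin k => (changeA a b θ ^ (i : ℕ)) v) := by
  have hv' : (a ^ k) v = b (companionMap (RingHom.id ℂ) h.toIsBComplete a k v S₀) := by
    simpa [companionMap_apply] using hv
  have key := companionMap_expansion h hv' hθ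
  intro S T hST
  refine (expansion_companion_bijective S₀ hθ).1 (hinj ?_)
  have h1 := key S
  have h2 := key T
  simp only [PowerSeries.map_id, companionMap_apply] at h1 h2
  exact h1.trans (hST.trans h2.symm)

/-- The module generated by `v` under `α` and the series in `β` does not depend on the change of
variable. -/
lemma mem_cyclic_change_iff (h : IsABModule a b)
    (hv : (a ^ k) v = b (expansion b (fun i : Fin k => (a ^ (i : ℕ)) v) S₀)) (hθ : IsChange θ)
    (w : M) : w ∈ cyclic (changeA a b θ) (changeB a b θ) v ↔
      ∃ S, w = expansion b (fun i : Fin k => (a ^ (i : ℕ)) v) S := by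
  have hv' : (a ^ k) v = b (companionMap (RingHom.id ℂ) h.toIsBComplete a k v S₀) := by
    simpa [companionMap_apply] using hv
  have hmap : ∀ s, companionMap (RingHom.id ℂ) h.toIsBComplete a k v s
      = expansion b (fun i : Fin k => (a ^ (i : ℕ)) v) s := fun s => by
    simp [companionMap_apply]
  constructor
  · intro hw
    have hle : cyclic (changeA a b θ) (changeB a b θ) v ≤
        LinearMap.range (companionMap (RingHom.id ℂ) h.toIsBComplete a k v) := by
      refine Submodule.span_le.mpr ?_
      rintro _ ⟨S, ν, rfl⟩
      refine ⟨opSeries (changedB (connA (companion S₀)) (stdB ℂ k) θ)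
        (changedB (connA (companion S₀)) (stdB ℂ k) θ) S
        ((opSeries (stdB ℂ k) (connA (companion S₀)) θ ^ ν) (companionGen ℂ k)), ?_⟩
      rw [companionMap_opSeries_changedB h hv' hθ, companionMap_change_pow_gen h hv']
      simp only [PowerSeries.map_id]
      rfl
    obtain ⟨S, hS⟩ := hle hw
    exact ⟨S, by rw [← hS, hmap]⟩
  · rintro ⟨S, rfl⟩
    obtain ⟨T, rfl⟩ := (expansion_companion_bijective S₀ hθ).2 S
    rw [← hmap, companionMap_expansion h hv' hθ]
    refine Submodule.sum_mem _ fun i _ => Submodule.subset_span ⟨T i, i, ?_⟩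
    simp only [PowerSeries.map_id]
    rfl

lemma exists_expansion_change_iff (h : IsABModule a b)
    (hv : (a ^ k) v = b (expansion b (fun i : Fin k => (a ^ (i : ℕ)) v) S₀)) (hθ : IsChange θ)
    (w : M) : (∃ S, w = expansion (changeB a b θ)
        (fun i : Fin k => (changeA a b θ ^ (i : ℕ)) v) S) ↔
      ∃ S, w = expansion b (fun i : Fin k => (a ^ (i : ℕ)) v) S := by
  have hv' : (a ^ k) v = b (companionMap (RingHom.id ℂ) h.toIsBComplete a k v S₀) := by
    simpa [companionMap_apply] using hv
  have key := companionMap_expansion h hv' hθ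
  simp only [PowerSeries.map_id, companionMap_apply] at key
  constructor
  · rintro ⟨S, rfl⟩
    exact ⟨_, (key S).symm⟩
  · rintro ⟨S, rfl⟩
    obtain ⟨T, rfl⟩ := (expansion_companion_bijective S₀ hθ).2 S
    exact ⟨T, key T⟩

lemma isFreeOfRank_change (h : IsABModule a b)
    (hv : (a ^ k) v = b (expansion b (fun i : Fin k => (a ^ (i : ℕ)) v) S₀))
    (hinj : Function.Injective (expansion b fun i : Fin k => (a ^ (i : ℕ)) v)) (hθ : IsChange θ) :
    IsFreeOfRank (changeB a b θ) k (cyclic (changeA a b θ) (changeB a b θ) v) := by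
  refine ⟨fun i => (changeA a b θ ^ (i : ℕ)) v, fun w => ?_, fun S hS i => ?_⟩
  · rw [mem_cyclic_change_iff h hv hθ, ← exists_expansion_change_iff h hv hθ]
    rfl
  · have h0 : expansion (changeB a b θ) (fun i : Fin k => (changeA a b θ ^ (i : ℕ)) v) 0 = 0 :=
      (expansionMap (h.change hθ).toIsBComplete
        fun i : Fin k => (changeA a b θ ^ (i : ℕ)) v).map_zero
    exact congrFun (expansion_change_injective h hv hinj hθ (hS.trans h0.symm)) i

/-- A generating family of `k` elements of a free submodule of rank `k` is a basis. -/
lemma expansion_injective_of_isFreeOfRank {N : ℕ} {P : Submodule ℂ (Xi N)}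
    (hP : IsFreeOfRank (xiB N) k P) (e : Fin k → Xi N)
    (he : ∀ w, w ∈ P ↔ ∃ S, w = expansion (xiB N) e S) :
    Function.Injective (expansion (xiB N) e) := by
  have lin : ∀ e : Fin k → Xi N, ∀ S, expansion (xiB N) e S
      = Fintype.linearCombination (PowerSeries ℂ) e S := by
    intro e S
    rw [expansion, Fintype.linearCombination_apply]
    exact Finset.sum_congr rfl fun i _ => opSeries_stdB _ _
  obtain ⟨e', h1, h2⟩ := hP
  set L := Fintype.linearCombination (PowerSeries ℂ) e
  set L' := Fintype.linearCombination (PowerSeries ℂ) e'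
  have h1' : ∀ w, w ∈ P ↔ ∃ S, w = L' S := fun w => by
    rw [h1]
    exact exists_congr fun S => by rw [← lin]; rfl
  have he' : ∀ w, w ∈ P ↔ ∃ S, w = L S := fun w => by
    rw [he]
    exact exists_congr fun S => by rw [← lin]
  have hL' : Function.Injective L' := by
    rw [injective_iff_map_eq_zero]
    intro S hS
    rw [← lin] at hS
    exact funext (h2 S hS)
  have hr : LinearMap.range L = LinearMap.range L' := by
    ext w
    simp only [LinearMap.mem_range, eq_comm (b := w)]
    rw [← he', ← h1']
  let Q := LinearEquiv.ofInjective L' hL'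
  let f : (Fin k → PowerSeries ℂ) →ₗ[PowerSeries ℂ] (Fin k → PowerSeries ℂ) :=
    Q.symm.toLinearMap.comp (L.codRestrict (LinearMap.range L') fun S => hr ▸ ⟨S, rfl⟩)
  have hf : ∀ S, L' (f S) = L S := by
    intro S
    have : Q (f S) = _ := Q.apply_symm_apply _
    exact congrArg Subtype.val this
  have hfs : Function.Surjective f := by
    intro T
    obtain ⟨S, hS⟩ : L' T ∈ LinearMap.range L := hr ▸ ⟨T, rfl⟩
    exact ⟨S, hL' (by rw [hf, hS])⟩
  -- As L and L' have the same image P, L factors as L' ∘ f with f a surjective endomorphism of a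
  -- finite free module, hence injective.
  have hfi := OrzechProperty.injective_of_surjective_endomorphism f hfs
  intro S T hST
  rw [lin, lin] at hST
  exact hfi (hL' (by rw [hf, hf]; exact hST))

end Fibre

/-! ### Rings of holomorphic functions -/

section HolRing

variable {X : Type*} [TopologicalSpace X] (𝒪 : ReducedComplexSpace X)

lemma ReducedComplexSpace.holAt_iff (y : X) : ∃ (n : ℕ) (χ : X → Fin n → ℂ), ∀ f : X → ℂ,
    𝒪.HolAt f y ↔ ∃ F : (Fin n → ℂ) → ℂ, AnalyticAt ℂ F (χ y) ∧ ∀ᶠ u in nhds y, f u = F (χ u) := by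
  obtain ⟨n, m, U, D, g, χ, -, hy, -, -, -, -, h⟩ := 𝒪.exists_local_model y
  exact ⟨n, χ, h y hy⟩

variable {𝒪}

lemma holAt_const (c : ℂ) (y : X) : 𝒪.HolAt (fun _ => c) y := by
  obtain ⟨n, χ, h⟩ := 𝒪.holAt_iff y
  exact (h _).mpr ⟨fun _ => c, analyticAt_const, Filter.Eventually.of_forall fun _ => rfl⟩

lemma HolAt.add {f g : X → ℂ} {y : X} (hf : 𝒪.HolAt f y) (hg : 𝒪.HolAt g y) :
    𝒪.HolAt (f + g) y := by
  obtain ⟨n, χ, h⟩ := 𝒪.holAt_iff y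
  obtain ⟨F, hF, hfF⟩ := (h f).mp hf
  obtain ⟨G, hG, hgG⟩ := (h g).mp hg
  refine (h _).mpr ⟨F + G, hF.add hG, ?_⟩
  filter_upwards [hfF, hgG] with u h1 h2
  simp [h1, h2]

lemma HolAt.mul {f g : X → ℂ} {y : X} (hf : 𝒪.HolAt f y) (hg : 𝒪.HolAt g y) :
    𝒪.HolAt (f * g) y := by
  obtain ⟨n, χ, h⟩ := 𝒪.holAt_iff y
  obtain ⟨F, hF, hfF⟩ := (h f).mp hf
  obtain ⟨G, hG, hgG⟩ := (h g).mp hg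
  refine (h _).mpr ⟨F * G, hF.mul hG, ?_⟩
  filter_upwards [hfF, hgG] with u h1 h2
  simp [h1, h2]

lemma HolAt.inv {f : X → ℂ} {y : X} (hf : 𝒪.HolAt f y) (h0 : f y ≠ 0) :
    𝒪.HolAt f⁻¹ y := by
  obtain ⟨n, χ, h⟩ := 𝒪.holAt_iff y
  obtain ⟨F, hF, hfF⟩ := (h f).mp hf
  refine (h _).mpr ⟨F⁻¹, hF.inv (hfF.self_of_nhds ▸ h0), ?_⟩
  filter_upwards [hfF] with u h1
  simp [h1]

lemma HolAt.congr {f g : X → ℂ} {y : X} (hf : 𝒪.HolAt f y) (h : f =ᶠ[nhds y] g) :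
    𝒪.HolAt g y := by
  obtain ⟨n, χ, hχ⟩ := 𝒪.holAt_iff y
  obtain ⟨F, hF, hfF⟩ := (hχ f).mp hf
  refine (hχ g).mpr ⟨F, hF, ?_⟩
  filter_upwards [hfF, h] with u h1 h2
  rw [← h2, h1]

/-- The ring `𝒪(V)`, as an algebra of functions on `V`. -/
def holRing (𝒪 : ReducedComplexSpace X) (V : Set X) : Subalgebra ℂ (V → ℂ) where
  carrier := {f | ∃ g : X → ℂ, 𝒪.HolOn V g ∧ ∀ x : V, f x = g x}
  mul_mem' := by
    rintro f f' ⟨g, hg, h⟩ ⟨g', hg', h'⟩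
    exact ⟨g * g', fun x hx => HolAt.mul (hg x hx) (hg' x hx), fun x => by simp [h, h']⟩
  add_mem' := by
    rintro f f' ⟨g, hg, h⟩ ⟨g', hg', h'⟩
    exact ⟨g + g', fun x hx => HolAt.add (hg x hx) (hg' x hx), fun x => by simp [h, h']⟩
  algebraMap_mem' c := ⟨fun _ => c, fun x _ => holAt_const c x, fun _ => rfl⟩

variable {V : Set X}

/-- Evaluation at a point. -/
def holEval (𝒪 : ReducedComplexSpace X) (x : V) : holRing 𝒪 V →ₐ[ℂ] ℂ :=
  (Pi.evalAlgHom ℂ (fun _ : V => ℂ) x).comp (holRing 𝒪 V).val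

lemma holEval_ext {f g : holRing 𝒪 V} (h : ∀ x, holEval 𝒪 x f = holEval 𝒪 x g) : f = g :=
  Subtype.ext (funext h)

/-- Evaluation at a point of the coefficients of a series. -/
noncomputable def seriesEval (𝒪 : ReducedComplexSpace X) (x : V) (S : PowerSeries (holRing 𝒪 V)) :
    PowerSeries ℂ :=
  PowerSeries.map (holEval 𝒪 x : holRing 𝒪 V →+* ℂ) S

lemma constantCoeff_seriesEval (x : V) (S : PowerSeries (holRing 𝒪 V)) :
    PowerSeries.constantCoeff (seriesEval 𝒪 x S)
      = holEval 𝒪 x (PowerSeries.constantCoeff S) := by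
  simp only [← PowerSeries.coeff_zero_eq_constantCoeff_apply, seriesEval, PowerSeries.coeff_map,
    RingHom.coe_coe]

/-- Makes the pointwise condition θ'(0)(x) ≠ 0 into the invertibility over 𝒪(V) demanded by
`IsChange`. -/
lemma isUnit_of_holEval_ne_zero {f : holRing 𝒪 V} (h : ∀ x, holEval 𝒪 x f ≠ 0) : IsUnit f := by
  obtain ⟨f, g, hg, hfg⟩ := f
  refine IsUnit.of_mul_eq_one ⟨f⁻¹, g⁻¹, fun x hx => HolAt.inv (hg x hx) ?_, fun x => ?_⟩ ?_
  · rw [← hfg ⟨x, hx⟩]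
    exact h ⟨x, hx⟩
  · simp [hfg]
  · exact Subtype.ext (funext fun x => mul_inv_cancel₀ (h x))

lemma exists_seriesEval_eq {S : X → PowerSeries ℂ} (hS : 𝒪.HolSeriesOn V S) :
    ∃ s : PowerSeries (holRing 𝒪 V), ∀ x : V, seriesEval 𝒪 x s = S x := by
  refine ⟨PowerSeries.mk fun n => ⟨fun x => PowerSeries.coeff n (S x), _, hS n, fun _ => rfl⟩,
    fun x => ?_⟩
  ext n
  simp [seriesEval, holEval]

lemma exists_holSeriesOn_eq (s : PowerSeries (holRing 𝒪 V)) :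
    ∃ S : X → PowerSeries ℂ, 𝒪.HolSeriesOn V S ∧ ∀ x : V, seriesEval 𝒪 x s = S x := by
  choose g hg h using fun n => (PowerSeries.coeff n s).2
  refine ⟨fun x => PowerSeries.mk fun n => g n x, fun n => ?_, fun x => ?_⟩
  · simpa using hg n
  · ext n
    simpa [seriesEval, holEval] using h n x

lemma exists_isChange {θ : X → PowerSeries ℂ} (hθ : 𝒪.HolSeriesOn V θ)
    (hc : ∀ x ∈ V, IsChange (θ x)) : ∃ t : PowerSeries (holRing 𝒪 V), IsChange t ∧
      ∀ x : V, seriesEval 𝒪 x t = θ x := by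
  obtain ⟨t, ht⟩ := exists_seriesEval_eq hθ
  have h : ∀ n (x : V), holEval 𝒪 x (PowerSeries.coeff n t) = PowerSeries.coeff n (θ x) := by
    intro n x
    rw [← ht x]
    simp [seriesEval]
  refine ⟨t, ⟨holEval_ext fun x => ?_, isUnit_of_holEval_ne_zero fun x => ?_⟩, ht⟩
  · rw [h, (hc x x.2).coeff_zero, map_zero]
  · rw [h]
    exact (hc x x.2).isUnit_coeff_one.ne_zero

lemma HolSeriesOn_mono {W : Set X} (hW : W ⊆ V) {S : X → PowerSeries ℂ}
    (hS : 𝒪.HolSeriesOn V S) : 𝒪.HolSeriesOn W S :=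
  fun n x hx => hS n x (hW hx)

end HolRing

/-! ### Sections -/

section Sections

variable {X : Type*} [TopologicalSpace X] {𝒪 : ReducedComplexSpace X} {N k : ℕ} {lam : ℚ}

lemma isABModule_xi (lam : ℚ) (N : ℕ) : IsABModule (xiA lam N) (xiB N) := by
  rw [xiA_eq_connA]
  exact isABModule_xiMatrix _ N

/-- `ψ` is on `W` a combination of the `Aⁱφ`, `i < k`, with coefficients in `𝒪(W)[[B]]`. -/
def InSpan (𝒪 : ReducedComplexSpace X) (A B : X → Module.End ℂ (Xi N)) (k : ℕ) (φ : X → Xi N)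
    (W : Set X) (ψ : X → Xi N) : Prop :=
  ∃ S : Fin k → X → PowerSeries ℂ, (∀ i, 𝒪.HolSeriesOn W (S i)) ∧
    ∀ x ∈ W, ψ x = expansion (B x) (fun i : Fin k => (A x ^ (i : ℕ)) (φ x)) (fun i => S i x)

/-- `φ` satisfies on `U` a relation `a^k φ = b ∑ Sᵢ aⁱ φ` and the `aⁱ φ`, `i < k`, are pointwise
independent. -/
structure HasRelation (𝒪 : ReducedComplexSpace X) (U : Set X) (lam : ℚ) (k : ℕ) (φ : X → Xi N)
    (S₀ : Fin k → X → PowerSeries ℂ) : Prop where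
  hol : HolMapOn 𝒪 U φ
  holS : ∀ i, 𝒪.HolSeriesOn U (S₀ i)
  rel : ∀ x ∈ U, (xiA lam N ^ k) (φ x) = xiB N (expansion (xiB N)
    (fun i : Fin k => (xiA lam N ^ (i : ℕ)) (φ x)) fun i => S₀ i x)
  inj : ∀ x ∈ U, Function.Injective (expansion (xiB N)
    (fun i : Fin k => (xiA lam N ^ (i : ℕ)) (φ x)))

variable {U W : Set X} {φ ψ : X → Xi N} {S₀ : Fin k → X → PowerSeries ℂ} {θ : X → PowerSeries ℂ}

/-- Evaluation at `x` of the sections parametrized by the companion module. -/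
noncomputable abbrev evalCompanion (𝒪 : ReducedComplexSpace X) (lam : ℚ) (k : ℕ) (φ : X → Xi N)
    (x : W) : (Fin k → PowerSeries (holRing 𝒪 W)) →ₛₗ[(holEval 𝒪 x : holRing 𝒪 W →+* ℂ)] Xi N :=
  companionMap _ (isABModule_xi lam N).toIsBComplete (xiA lam N) k (φ x)

/-- The dictionary between sections and algebra: combinations of the aⁱφ are the evaluations of
elements of a single module over 𝒪(W). -/
lemma inSpan_iff_evalCompanion :
    InSpan 𝒪 (fun _ => xiA lam N) (fun _ => xiB N) k φ W ψ ↔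
      ∃ s : Fin k → PowerSeries (holRing 𝒪 W), ∀ x : W, ψ x = evalCompanion 𝒪 lam k φ x s := by
  constructor
  · rintro ⟨S, hS, h⟩
    choose s hs using fun i => exists_seriesEval_eq (hS i)
    refine ⟨s, fun x => ?_⟩
    rw [h x x.2, companionMap_apply]
    simp only [← hs]
    rfl
  · rintro ⟨s, h⟩
    choose S hS hs using fun i => exists_holSeriesOn_eq (s i)
    refine ⟨S, hS, fun x hx => ?_⟩
    rw [h ⟨x, hx⟩, companionMap_apply]
    simp only [← fun i => hs i ⟨x, hx⟩]
    rfl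

/-- The companion module over `𝒪(W)`, together with a change of variable over `𝒪(W)`. -/
lemma HasRelation.exists_companion (hφ : HasRelation 𝒪 U lam k φ S₀) (hW : W ⊆ U)
    (hθ : 𝒪.HolSeriesOn W θ) (hc : ∀ x ∈ W, IsChange (θ x)) :
    ∃ (s₀ : Fin k → PowerSeries (holRing 𝒪 W)) (t : PowerSeries (holRing 𝒪 W)), IsChange t ∧
      (∀ x : W, seriesEval 𝒪 x t = θ x) ∧ ∀ x : W, (xiA lam N ^ k) (φ x)
        = xiB N (evalCompanion 𝒪 lam k φ x s₀) := by
  obtain ⟨t, ht, ht'⟩ := exists_isChange hθ hc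
  choose s₀ hs₀ using fun i => exists_seriesEval_eq (HolSeriesOn_mono hW (hφ.holS i))
  refine ⟨s₀, t, ht, ht', fun x => ?_⟩
  rw [hφ.rel x (hW x.2), companionMap_apply]
  simp only [← hs₀]
  rfl

section

variable (hφ : HasRelation 𝒪 U lam k φ S₀) (hW : W ⊆ U)
  (hθ : 𝒪.HolSeriesOn W θ) (hc : ∀ x ∈ W, IsChange (θ x))

include hφ hW hθ hc

/-- The β-expansion is bijective already over 𝒪(W), so passing between `b`- and β-coefficients keeps
them holomorphic; evaluation then gives the identity at each point. -/
lemma HasRelation.inSpan_change_iff :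
    InSpan 𝒪 (fun x => changeA (xiA lam N) (xiB N) (θ x))
      (fun x => changeB (xiA lam N) (xiB N) (θ x)) k φ W ψ ↔
        InSpan 𝒪 (fun _ => xiA lam N) (fun _ => xiB N) k φ W ψ := by
  obtain ⟨s₀, t, ht, ht', hs₀⟩ := hφ.exists_companion hW hθ hc
  have hbij := expansion_companion_bijective s₀ ht
  have key : ∀ (x : W) s, evalCompanion 𝒪 lam k φ x
      (expansion (changedB (connA (companion s₀)) (stdB _ k) t)
        (fun i : Fin k => (opSeries (stdB _ k) (connA (companion s₀)) t ^ (i : ℕ))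
          (companionGen _ k)) s)
      = expansion (changeB (xiA lam N) (xiB N) (θ x))
        (fun i : Fin k => (changeA (xiA lam N) (xiB N) (θ x) ^ (i : ℕ)) (φ x))
        (fun i => seriesEval 𝒪 x (s i)) := by
    intro x s
    rw [← ht']
    exact companionMap_expansion (isABModule_xi lam N) (hs₀ x) ht s
  rw [inSpan_iff_evalCompanion]
  constructor
  · rintro ⟨S, hS, h⟩
    choose s hs using fun i => exists_seriesEval_eq (hS i)
    refine ⟨_, fun x => (h x x.2).trans (Eq.trans ?_ (key x s).symm)⟩
    simp only [hs]
  · rintro ⟨s, h⟩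
    obtain ⟨s, rfl⟩ := hbij.2 s
    choose S hS hs using fun i => exists_holSeriesOn_eq (s i)
    refine ⟨S, hS, fun x hx => ?_⟩
    rw [h ⟨x, hx⟩, key ⟨x, hx⟩]
    simp only [hs]

/-- Every power of α applied to the generator lies in the companion module, so powers of order k and
above bring nothing new. -/
lemma HasRelation.inSpan_of_sum {n : ℕ} {S : ℕ → X → PowerSeries ℂ}
    (hS : ∀ ν, 𝒪.HolSeriesOn W (S ν))
    (h : ∀ x ∈ W, ψ x = ∑ ν ∈ Finset.range n, bSeries (changeB (xiA lam N) (xiB N) (θ x)) (S ν x)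
      ((changeA (xiA lam N) (xiB N) (θ x) ^ ν) (φ x))) :
    InSpan 𝒪 (fun _ => xiA lam N) (fun _ => xiB N) k φ W ψ := by
  obtain ⟨s₀, t, ht, ht', hs₀⟩ := hφ.exists_companion hW hθ hc
  choose s hs using fun ν => exists_seriesEval_eq (hS ν)
  rw [inSpan_iff_evalCompanion]
  refine ⟨∑ ν ∈ Finset.range n, opSeries (changedB (connA (companion s₀)) (stdB _ k) t)
    (changedB (connA (companion s₀)) (stdB _ k) t) (s ν)
      ((opSeries (stdB _ k) (connA (companion s₀)) t ^ ν) (companionGen _ k)), fun x => ?_⟩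
  rw [h x x.2, map_sum]
  refine Finset.sum_congr rfl fun ν _ => ?_
  rw [companionMap_opSeries_changedB (isABModule_xi lam N) (hs₀ x) ht,
    companionMap_change_pow_gen (isABModule_xi lam N) (hs₀ x), ← hs, ← ht']
  rfl

lemma HasRelation.inSpan_changeA
    (h : InSpan 𝒪 (fun _ => xiA lam N) (fun _ => xiB N) k φ W ψ) :
    InSpan 𝒪 (fun _ => xiA lam N) (fun _ => xiB N) k φ W
      (fun x => changeA (xiA lam N) (xiB N) (θ x) (ψ x)) := by
  obtain ⟨s₀, t, ht, ht', hs₀⟩ := hφ.exists_companion hW hθ hc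
  rw [inSpan_iff_evalCompanion] at h ⊢
  obtain ⟨s, h⟩ := h
  refine ⟨opSeries (stdB _ k) (connA (companion s₀)) t s, fun x => ?_⟩
  rw [companionMap_opSeries (isABModule_xi lam N) (hs₀ x), h, ← ht']
  rfl

lemma HasRelation.exists_inSpan_pow : ∃ ψ,
    InSpan 𝒪 (fun _ => xiA lam N) (fun _ => xiB N) k φ W ψ ∧ ∀ x ∈ W,
      (changeA (xiA lam N) (xiB N) (θ x) ^ k) (φ x)
        = changeB (xiA lam N) (xiB N) (θ x) (ψ x) := by
  classical
  obtain ⟨s₀, t, ht, ht', hs₀⟩ := hφ.exists_companion hW hθ hc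
  obtain ⟨z, hz⟩ := change_pow_gen_mem_range s₀ ht
  -- The value 0 off W is only there to have a function on all of X.
  refine ⟨fun x => if hx : x ∈ W then evalCompanion 𝒪 lam k φ ⟨x, hx⟩ z else 0,
    inSpan_iff_evalCompanion.mpr ⟨z, fun x => ?_⟩, fun x hx => ?_⟩
  · rw [dif_pos x.2]
  · have h1 := congrArg (evalCompanion 𝒪 lam k φ ⟨x, hx⟩) hz
    rw [companionMap_change_pow_gen (isABModule_xi lam N) (hs₀ ⟨x, hx⟩),
      companionMap_changedB (isABModule_xi lam N) (hs₀ ⟨x, hx⟩)] at h1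
    beta_reduce
    rw [dif_pos hx, ← ht' ⟨x, hx⟩]
    exact h1

end

end Sections

/-! ### Thematic maps and their sheaves under a change of variable. -/

section Thematic

variable {X : Type*} [TopologicalSpace X] {𝒪 : ReducedComplexSpace X} {N k : ℕ} {lam : ℚ}
  {U V W : Set X} {φ ψ : X → Xi N} {S₀ : Fin k → X → PowerSeries ℂ} {θ : X → PowerSeries ℂ}

lemma holSeriesOn_const (V : Set X) (S : PowerSeries ℂ) : 𝒪.HolSeriesOn V fun _ => S :=
  fun _ x _ => holAt_const _ x

lemma changeA_X (lam : ℚ) (N : ℕ) : changeA (xiA lam N) (xiB N) PowerSeries.X = xiA lam N :=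
  opSeries_X (isABModule_xi lam N).toIsBComplete (isABModule_xi lam N).isContracting

lemma changeB_X (lam : ℚ) (N : ℕ) : changeB (xiA lam N) (xiB N) PowerSeries.X = xiB N :=
  changedB_X (isABModule_xi lam N)

/-- Local combinations of the `aⁱφ` glue. -/
lemma HasRelation.inSpan_of_locally (hφ : HasRelation 𝒪 U lam k φ S₀) (hV : IsOpen V) (hVU : V ⊆ U)
    (h : ∀ y ∈ V, ∃ W, IsOpen W ∧ y ∈ W ∧ W ⊆ U ∧
      InSpan 𝒪 (fun _ => xiA lam N) (fun _ => xiB N) k φ W ψ) :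
    InSpan 𝒪 (fun _ => xiA lam N) (fun _ => xiB N) k φ V ψ := by
  classical
  choose! W hWo hyW hWU S hS hψ using h
  -- The coefficient at x is taken from the neighbourhood chosen for x. By pointwise independence it
  -- agrees near y with the coefficients chosen for y, hence it is holomorphic.
  refine ⟨fun i x => S x i x, fun i n y hy => ?_, fun x hx => hψ x hx x (hyW x hx)⟩
  refine HolAt.congr (hS y hy i n y (hyW y hy)) ?_
  filter_upwards [(hWo y hy).mem_nhds (hyW y hy), hV.mem_nhds hy] with u hu hu'
  have := hφ.inj u (hVU hu') ((hψ y hy u hu).symm.trans (hψ u hu' u (hyW u hu')))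
  rw [congrFun this i]

/-- The right side does not involve θ: the sheaf generated under (α, β) is the one generated under
(a, b), which is the case θ = X. -/
lemma HasRelation.isSectionAt_iff (hU : IsOpen U) (hφ : HasRelation 𝒪 U lam k φ S₀)
    (hθ : 𝒪.HolSeriesOn U θ) (hc : ∀ x ∈ U, IsChange (θ x)) {y : X} (hy : y ∈ U) :
    IsSectionAt 𝒪 (fun x => changeA (xiA lam N) (xiB N) (θ x))
      (fun x => changeB (xiA lam N) (xiB N) (θ x)) φ y ψ ↔
    ∃ W, IsOpen W ∧ y ∈ W ∧ W ⊆ U ∧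
      InSpan 𝒪 (fun _ => xiA lam N) (fun _ => xiB N) k φ W ψ := by
  constructor
  · rintro ⟨W, hW, hyW, n, S, hS, h⟩
    refine ⟨W ∩ U, hW.inter hU, ⟨hyW, hy⟩, Set.inter_subset_right, ?_⟩
    exact hφ.inSpan_of_sum Set.inter_subset_right (HolSeriesOn_mono Set.inter_subset_right hθ)
      (fun x hx => hc x hx.2) (fun ν => HolSeriesOn_mono Set.inter_subset_left (hS ν))
      fun x hx => h x hx.1
  · rintro ⟨W, hW, hyW, hWU, h⟩
    obtain ⟨S, hS, h⟩ := (hφ.inSpan_change_iff hWU (HolSeriesOn_mono hWU hθ)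
      fun x hx => hc x (hWU hx)).mpr h
    refine ⟨W, hW, hyW, k, fun ν => if hν : ν < k then S ⟨ν, hν⟩ else fun _ => 0, fun ν => ?_,
      fun x hx => ?_⟩
    · dsimp only
      split_ifs
      · exact hS _
      · exact holSeriesOn_const _ _
    · rw [h x hx, Finset.sum_range]
      refine Finset.sum_congr rfl fun i _ => ?_
      beta_reduce
      rw [dif_pos i.2]
      rfl

lemma HasRelation.isSectionAt_self_iff (hU : IsOpen U) (hφ : HasRelation 𝒪 U lam k φ S₀) {y : X}
    (hy : y ∈ U) : IsSectionAt 𝒪 (fun _ => xiA lam N) (fun _ => xiB N) φ y ψ ↔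
      ∃ W, IsOpen W ∧ y ∈ W ∧ W ⊆ U ∧
        InSpan 𝒪 (fun _ => xiA lam N) (fun _ => xiB N) k φ W ψ := by
  have := hφ.isSectionAt_iff (ψ := ψ) hU (holSeriesOn_const U PowerSeries.X)
    (fun _ _ => isChange_X ℂ) hy
  simpa only [changeA_X, changeB_X] using this

lemma HasRelation.isSectionOn_iff (hU : IsOpen U) (hφ : HasRelation 𝒪 U lam k φ S₀)
    (hθ : 𝒪.HolSeriesOn U θ) (hc : ∀ x ∈ U, IsChange (θ x)) (hV : IsOpen V) (hVU : V ⊆ U) :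
    IsSectionOn 𝒪 (fun x => changeA (xiA lam N) (xiB N) (θ x))
      (fun x => changeB (xiA lam N) (xiB N) (θ x)) φ V ψ ↔
    InSpan 𝒪 (fun _ => xiA lam N) (fun _ => xiB N) k φ V ψ := by
  constructor
  · intro h
    exact hφ.inSpan_of_locally hV hVU fun y hy =>
      (hφ.isSectionAt_iff hU hθ hc (hVU hy)).mp (h y hy)
  · intro h y hy
    exact (hφ.isSectionAt_iff hU hθ hc (hVU hy)).mpr ⟨V, hV, hy, hVU, h⟩

lemma HasRelation.isSectionOn_self_iff (hU : IsOpen U) (hφ : HasRelation 𝒪 U lam k φ S₀)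
    (hV : IsOpen V) (hVU : V ⊆ U) :
    IsSectionOn 𝒪 (fun _ => xiA lam N) (fun _ => xiB N) φ V ψ ↔
      InSpan 𝒪 (fun _ => xiA lam N) (fun _ => xiB N) k φ V ψ := by
  have := hφ.isSectionOn_iff (ψ := ψ) hU (holSeriesOn_const U PowerSeries.X)
    (fun _ _ => isChange_X ℂ) hV hVU
  simpa only [changeA_X, changeB_X] using this

/-- The sheaf `sec` is left free so that the lemma serves both for the original sheaf and for the
one generated by the new operators. -/
lemma HasRelation.isSheafBasis (hφ : HasRelation 𝒪 U lam k φ S₀)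
    (hθ : 𝒪.HolSeriesOn U θ) (hc : ∀ x ∈ U, IsChange (θ x)) {sec : Set X → (X → Xi N) → Prop}
    (hsec : ∀ V ψ, IsOpen V → V ⊆ U → (sec V ψ ↔
      InSpan 𝒪 (fun _ => xiA lam N) (fun _ => xiB N) k φ V ψ)) :
    IsSheafBasis 𝒪 U (fun x => changeB (xiA lam N) (xiB N) (θ x)) sec
      (fun (i : Fin k) x => (changeA (xiA lam N) (xiB N) (θ x) ^ (i : ℕ)) (φ x)) := by
  refine fun V hV hVU => ⟨fun ψ => ?_, fun S _ h i x hx => ?_⟩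
  · rw [hsec V ψ hV hVU, ← hφ.inSpan_change_iff hVU (HolSeriesOn_mono hVU hθ)
      fun x hx => hc x (hVU hx)]
    rfl
  · have hab := isABModule_xi lam N
    have hcx := hc x (hVU hx)
    have h0 : expansion (changeB (xiA lam N) (xiB N) (θ x))
        (fun i : Fin k => (changeA (xiA lam N) (xiB N) (θ x) ^ (i : ℕ)) (φ x)) 0 = 0 :=
      (expansionMap (hab.change hcx).toIsBComplete
        fun i : Fin k => (changeA (xiA lam N) (xiB N) (θ x) ^ (i : ℕ)) (φ x)).map_zero
    exact congrFun (expansion_change_injective hab (hφ.rel x (hVU hx)) (hφ.inj x (hVU hx)) hcx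
      (a₁ := fun i => S i x) (a₂ := 0) ((h x hx).trans h0.symm)) i

theorem HasRelation.isThematic (hU : IsOpen U) (hφ : HasRelation 𝒪 U lam k φ S₀)
    (hθ : 𝒪.HolSeriesOn U θ) (hc : ∀ x ∈ U, IsChange (θ x)) :
    IsThematic 𝒪 U (fun x => changeA (xiA lam N) (xiB N) (θ x))
      (fun x => changeB (xiA lam N) (xiB N) (θ x)) k φ where
  hol := hφ.hol
  rank x hx := isFreeOfRank_change (isABModule_xi lam N) (hφ.rel x hx) (hφ.inj x hx) (hc x hx)
  basis := hφ.isSheafBasis hθ hc fun _ _ hV hVU => hφ.isSectionOn_iff hU hθ hc hV hVU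
  pow_mem := by
    obtain ⟨ψ, h1, h2⟩ := hφ.exists_inSpan_pow subset_rfl hθ hc
    exact ⟨ψ, (hφ.isSectionOn_iff hU hθ hc hU subset_rfl).mpr h1, h2⟩

theorem HasRelation.isThematic_self (hU : IsOpen U) (hφ : HasRelation 𝒪 U lam k φ S₀) :
    IsThematic 𝒪 U (fun _ => xiA lam N) (fun _ => xiB N) k φ := by
  have := hφ.isThematic hU (holSeriesOn_const U PowerSeries.X) (fun _ _ => isChange_X ℂ)
  simpa only [changeA_X, changeB_X] using this

lemma HasRelation.mem_cyclic_iff (hφ : HasRelation 𝒪 U lam k φ S₀) {x : X} (hx : x ∈ U)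
    (w : Xi N) : w ∈ cyclic (xiA lam N) (xiB N) (φ x) ↔
      ∃ S, w = expansion (xiB N) (fun i : Fin k => (xiA lam N ^ (i : ℕ)) (φ x)) S := by
  have := mem_cyclic_change_iff (isABModule_xi lam N) (hφ.rel x hx) (isChange_X ℂ) w
  rwa [changeA_X, changeB_X] at this

theorem IsThematic.exists_hasRelation (hU : IsOpen U)
    (h : IsThematic 𝒪 U (fun _ => xiA lam N) (fun _ => xiB N) k φ) :
    ∃ S₀ : Fin k → X → PowerSeries ℂ, HasRelation 𝒪 U lam k φ S₀ := by
  obtain ⟨ψ, hψ, hrel⟩ := h.pow_mem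
  obtain ⟨S₀, hS₀, h0⟩ := ((h.basis U hU subset_rfl).1 ψ).mp hψ
  have hrel' : ∀ x ∈ U, (xiA lam N ^ k) (φ x) = xiB N (expansion (xiB N)
      (fun i : Fin k => (xiA lam N ^ (i : ℕ)) (φ x)) fun i => S₀ i x) := by
    intro x hx
    rw [hrel x hx, h0 x hx]
    rfl
  refine ⟨S₀, h.hol, hS₀, hrel', fun x hx => ?_⟩
  -- The sheaf basis only excludes relations over open sets; independence in the fibre at x comes
  -- from the rank.
  refine expansion_injective_of_isFreeOfRank (h.rank x hx) _ fun w => ?_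
  have := mem_cyclic_change_iff (isABModule_xi lam N) (hrel' x hx) (isChange_X ℂ) w
  rwa [changeA_X, changeB_X] at this

end Thematic

/-! ### The isomorphism of `Ξ` with its change of variable -/

section Conjugation

variable {X : Type*} [TopologicalSpace X] {𝒪 : ReducedComplexSpace X} {lam : ℚ}
  {θ : X → PowerSeries ℂ}

lemma mapVec_xi {W : Set X} (N : ℕ) (x : W) (v : Fin N → PowerSeries (holRing 𝒪 W)) :
    mapVec (holEval 𝒪 x : holRing 𝒪 W →+* ℂ) N
      (connA (xiMatrix (algebraMap ℂ (holRing 𝒪 W) lam) N) v)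
        = xiA lam N (mapVec (holEval 𝒪 x : holRing 𝒪 W →+* ℂ) N v) := by
  rw [mapVec_connA, xiA_eq_connA]
  simp only [map_xiMatrix, RingHom.coe_coe, AlgHom.commutes, Algebra.algebraMap_self_apply]

noncomputable instance (W : Set X) : Algebra ℚ (holRing 𝒪 W) :=
  ((algebraMap ℂ (holRing 𝒪 W)).comp (algebraMap ℚ ℂ)).toAlgebra

/-- T(x) sends ∑ Sⱼ(b)eⱼ to ∑ Sⱼ(β)e'ⱼ(x), with e' the family of `exists_xi_family` over 𝒪(X). It is
bijective because e' is the standard basis modulo `b`. -/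
theorem exists_conjugation (N : ℕ) (hθ : 𝒪.HolSeriesOn Set.univ θ) (hc : ∀ x, IsChange (θ x)) :
    ∃ T : X → Xi N ≃ₗ[ℂ] Xi N,
      (∀ x v, T x (xiA lam N v) = changeA (xiA lam N) (xiB N) (θ x) (T x v)) ∧
      (∀ x v, T x (xiB N v) = changeB (xiA lam N) (xiB N) (θ x) (T x v)) ∧
      ∀ (U : Set X) (φ : X → Xi N), IsOpen U → HolMapOn 𝒪 U φ →
        HolMapOn 𝒪 U fun x => (T x).symm (φ x) := by
  have hab := isABModule_xi lam N
  obtain ⟨t, ht, ht'⟩ := exists_isChange hθ fun x _ => hc x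
  obtain ⟨e, he, he0⟩ := exists_xi_family (algebraMap ℂ (holRing 𝒪 Set.univ) lam) N ht
  have habR := isABModule_xiMatrix (algebraMap ℂ (holRing 𝒪 Set.univ) lam) N
  choose E hE hE' using fun l j => exists_holSeriesOn_eq (e l j)
  have hEe : ∀ (x : (Set.univ : Set X)) l, mapVec (holEval 𝒪 x : holRing 𝒪 Set.univ →+* ℂ) N (e l)
      = fun j => E l j x := fun x l => funext fun j => hE' l j x
  have hrel : ∀ x l, changeA (xiA lam N) (xiB N) (θ x) (fun j => E l j x)
      = ∑ j, opSeries (changeB (xiA lam N) (xiB N) (θ x)) (changeB (xiA lam N) (xiB N) (θ x))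
        (xiMatrix (lam : ℂ) N j l) (fun i => E j i x) := by
    intro x l
    have h1 := congrArg
      (mapVec (holEval 𝒪 (⟨x, Set.mem_univ x⟩ : (Set.univ : Set X)) : holRing 𝒪 Set.univ →+* ℂ) N)
      (he l)
    rw [map_opSeries habR.toIsBComplete habR.isContracting hab.toIsBComplete hab.isContracting _
      (mapVec_stdB _) (mapVec_xi N _), map_sum, hEe] at h1
    have h2 := map_changedB habR hab _ (mapVec_xi (𝒪 := 𝒪) N ⟨x, Set.mem_univ x⟩) (mapVec_stdB _) t
    simp only [map_opSeries (habR.change ht).toIsBComplete (isContracting_self _)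
      (hab.change (ht.map _)).toIsBComplete (isContracting_self _) _ h2 h2, hEe, map_xiMatrix,
      RingHom.coe_coe, AlgHom.commutes, Algebra.algebraMap_self_apply] at h1
    rw [← ht' ⟨x, Set.mem_univ x⟩]
    exact h1
  have hE0 : ∀ x l j, PowerSeries.constantCoeff (E l j x) = if l = j then 1 else 0 := by
    intro x l j
    rw [← hE' l j ⟨x, Set.mem_univ x⟩, constantCoeff_seriesEval, he0]
    split_ifs <;> simp
  have hbij : ∀ x, Function.Bijective
      (expansion (changeB (xiA lam N) (xiB N) (θ x)) fun l j => E l j x) := by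
    intro x
    refine expansion_bijective_of_isUnit_det (hab.change (hc x)).toIsBComplete
      (range_changedB hab (hc x)) _ ?_
    rw [show (Matrix.of fun i j => PowerSeries.constantCoeff (E i j x)) = 1 from
      Matrix.ext fun i j => by rw [Matrix.of_apply, hE0, Matrix.one_apply], Matrix.det_one]
    exact isUnit_one
  refine ⟨fun x => LinearEquiv.ofBijective
    (expansionMap (hab.change (hc x)).toIsBComplete fun l j => E l j x) (hbij x),
    fun x v => ?_, fun x v => ?_, fun U φ hU hφ => ?_⟩
  · have h1 := expansion_connA (hab.change (hc x)) _ _ (hrel x) v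
    rw [← xiA_eq_connA] at h1
    exact h1
  · exact expansion_stdB (hab.change (hc x)).toIsBComplete _ v
  -- For holomorphy of the inverse, φ is expanded over 𝒪(U), where the β-expansion is again
  -- bijective; by uniqueness in the fibres its coefficients are those of T(x)⁻¹φ(x).
  · obtain ⟨tU, htU, htU'⟩ := exists_isChange (HolSeriesOn_mono (Set.subset_univ U) hθ)
      fun x _ => hc x
    have habU := isABModule_xiMatrix (algebraMap ℂ (holRing 𝒪 U) lam) N
    choose eU heU using fun l j =>
      exists_seriesEval_eq (HolSeriesOn_mono (Set.subset_univ U) (hE l j))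
    choose Φ hΦ using fun j => exists_seriesEval_eq (hφ j)
    have hbijU : Function.Bijective (expansion
        (changedB (connA (xiMatrix (algebraMap ℂ (holRing 𝒪 U) lam) N)) (stdB _ N) tU) eU) := by
      refine expansion_bijective_of_isUnit_det (habU.change htU).toIsBComplete
        (range_changedB habU htU) _ ?_
      rw [show (Matrix.of fun i j => PowerSeries.constantCoeff (eU i j)) = 1 from ?_,
        Matrix.det_one]
      · exact isUnit_one
      · refine Matrix.ext fun i j => holEval_ext fun x => ?_
        have h1 := hE0 x i j
        rw [← heU, constantCoeff_seriesEval] at h1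
        rw [Matrix.of_apply, Matrix.one_apply]
        refine h1.trans ?_
        split_ifs <;> simp
    obtain ⟨v, hv⟩ := hbijU.2 Φ
    choose S hS hS' using fun j => exists_holSeriesOn_eq (v j)
    have key : ∀ x (hx : x ∈ U), expansion (changeB (xiA lam N) (xiB N) (θ x))
        (fun l j => E l j x) (fun j => S j x) = φ x := by
      intro x hx
      have h1 := congrArg (mapVec (holEval 𝒪 (⟨x, hx⟩ : U) : holRing 𝒪 U →+* ℂ) N) hv
      have h2 := map_changedB habU hab _ (mapVec_xi (𝒪 := 𝒪) N ⟨x, hx⟩) (mapVec_stdB _) tU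
      rw [map_expansion _ (habU.change htU).toIsBComplete (hab.change (htU.map _)).toIsBComplete _
        h2] at h1
      have h3 : mapVec (holEval 𝒪 (⟨x, hx⟩ : U) : holRing 𝒪 U →+* ℂ) N Φ = φ x :=
        funext fun j => hΦ j ⟨x, hx⟩
      rw [h3] at h1
      rw [← h1, ← htU' ⟨x, hx⟩]
      simp only [← fun l j => heU l j ⟨x, hx⟩, ← fun j => hS' j ⟨x, hx⟩]
      rfl
    intro j n x hx
    refine HolAt.congr (hS j n x hx) ?_
    filter_upwards [hU.mem_nhds hx] with u hu
    have : (fun j => S j u) = (LinearEquiv.ofBijective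
        (expansionMap (hab.change (hc u)).toIsBComplete fun l j => E l j u) (hbij u)).symm (φ u) := by
      rw [LinearEquiv.eq_symm_apply]
      exact key u hu
    rw [← this]

end Conjugation

/-! ### Change of variable in families of themes -/

section ConjugationSymm

variable {X : Type*} {N : ℕ} {lam : ℚ} {θ : X → PowerSeries ℂ} {T : X → Xi N ≃ₗ[ℂ] Xi N}
  (hTa : ∀ x v, T x (xiA lam N v) = changeA (xiA lam N) (xiB N) (θ x) (T x v))
  (hTb : ∀ x v, T x (xiB N v) = changeB (xiA lam N) (xiB N) (θ x) (T x v))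

include hTa in
lemma conjugation_symm_changeA (x : X) (v : Xi N) :
    (T x).symm (changeA (xiA lam N) (xiB N) (θ x) v) = xiA lam N ((T x).symm v) := by
  rw [LinearEquiv.symm_apply_eq, hTa, LinearEquiv.apply_symm_apply]

include hTb in
lemma conjugation_symm_changeB (x : X) (v : Xi N) :
    (T x).symm (changeB (xiA lam N) (xiB N) (θ x) v) = xiB N ((T x).symm v) := by
  rw [LinearEquiv.symm_apply_eq, hTb, LinearEquiv.apply_symm_apply]

include hTa in
lemma conjugation_symm_changeA_pow (x : X) (i : ℕ) (v : Xi N) :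
    (T x).symm ((changeA (xiA lam N) (xiB N) (θ x) ^ i) v)
      = (xiA lam N ^ i) ((T x).symm v) :=
  map_pow_apply (T x).symm.toLinearMap (conjugation_symm_changeA hTa x) i v

include hTa hTb in
lemma conjugation_symm_expansion {k : ℕ} (hc : ∀ x, IsChange (θ x)) (x : X) (v : Xi N) (S : Fin k → PowerSeries ℂ) :
    (T x).symm (expansion (changeB (xiA lam N) (xiB N) (θ x))
        (fun i : Fin k => (changeA (xiA lam N) (xiB N) (θ x) ^ (i : ℕ)) v) S)
      = expansion (xiB N) (fun i : Fin k => (xiA lam N ^ (i : ℕ)) ((T x).symm v)) S := by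
  have hab := isABModule_xi lam N
  have h := map_expansion (RingHom.id ℂ) (hab.change (hc x)).toIsBComplete hab.toIsBComplete
    (T x).symm.toLinearMap (conjugation_symm_changeB hTb x)
    (fun i : Fin k => (changeA (xiA lam N) (xiB N) (θ x) ^ (i : ℕ)) v) S
  simp only [PowerSeries.map_id, LinearEquiv.coe_coe,
    conjugation_symm_changeA_pow hTa x] at h
  exact h

end ConjugationSymm

section Families

variable {X : Type*} [TopologicalSpace X] {𝒪 : ReducedComplexSpace X} {N k : ℕ} {lam : ℚ}
  {U W : Set X} {φ ψ : X → Xi N} {S₀ : Fin k → X → PowerSeries ℂ} {θ : X → PowerSeries ℂ}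

lemma IsRelativeChangeOfVariable.isChange (hθ : IsRelativeChangeOfVariable 𝒪 θ) (x : X) :
    IsChange (θ x) :=
  ⟨(hθ.2 x).1, (hθ.2 x).2.isUnit⟩

/-- The fibre is not assumed complete: completeness is transported from the companion module, and it
makes θ(a) and θ'(a) on the fibre genuine sums rather than the default value 0. -/
lemma isABModule_of_isIsoOnto {M : Type*} [AddCommGroup M] [Module ℂ M] {a b : Module.End ℂ M}
    (hφ : HasRelation 𝒪 U lam k φ S₀) {x : X} (hx : x ∈ U) {f : M →ₗ[ℂ] Xi N}
    (hf : IsIsoOnto a b (xiA lam N) (xiB N) (cyclic (xiA lam N) (xiB N) (φ x)) f) :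
    IsABModule a b := by
  obtain ⟨hinj, hran, hfa, hfb⟩ := hf
  have hab := isABModule_xi lam N
  let J := expansionMap hab.toIsBComplete (fun i : Fin k => (xiA lam N ^ (i : ℕ)) (φ x))
  have hr : LinearMap.range J = LinearMap.range f := by
    ext w
    rw [hran, hφ.mem_cyclic_iff hx]
    exact exists_congr fun S => eq_comm
  let e := (LinearEquiv.ofInjective J (hφ.inj x hx)).trans
    ((LinearEquiv.ofEq _ _ hr).trans (LinearEquiv.ofInjective f hinj).symm)
  have he : ∀ s, f (e s) = J s := by
    intro s
    have : LinearEquiv.ofInjective f hinj (e s) = _ := LinearEquiv.apply_symm_apply _ _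
    exact congrArg Subtype.val this
  refine (isABModule_companion fun i => S₀ i x).of_equiv e (fun s => hinj ?_) fun s => hinj ?_
  · rw [he, hfa, he]
    exact expansion_companion hab (hφ.rel x hx) s
  · rw [he, hfb, he]
    exact expansion_stdB hab.toIsBComplete _ s

variable {T : X → Xi N ≃ₗ[ℂ] Xi N}
  (hTa : ∀ x v, T x (xiA lam N v) = changeA (xiA lam N) (xiB N) (θ x) (T x v))
  (hTb : ∀ x v, T x (xiB N v) = changeB (xiA lam N) (xiB N) (θ x) (T x v))
variable (hc : ∀ x, IsChange (θ x))

include hTa hTb hc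

lemma inSpan_conjugation_iff :
    InSpan 𝒪 (fun _ => xiA lam N) (fun _ => xiB N) k (fun x => (T x).symm (φ x)) W
        (fun x => (T x).symm (ψ x)) ↔
      InSpan 𝒪 (fun x => changeA (xiA lam N) (xiB N) (θ x))
        (fun x => changeB (xiA lam N) (xiB N) (θ x)) k φ W ψ := by
  refine exists_congr fun S => and_congr_right fun _ => forall₂_congr fun x _ => ?_
  rw [← conjugation_symm_expansion hTa hTb hc, EmbeddingLike.apply_eq_iff_eq]

/-- The image of f is the same submodule whether expanded in (a, b) or in (α, β), and T(x)⁻¹ carries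
the second description to the submodule generated by T(x)⁻¹φ(x). -/
lemma HasRelation.isIsoOnto_conjugation {S₀' : Fin k → X → PowerSeries ℂ}
    (hφ : HasRelation 𝒪 U lam k φ S₀)
    (hφ' : HasRelation 𝒪 U lam k (fun x => (T x).symm (φ x)) S₀') {x : X} (hx : x ∈ U)
    {M : Type*} [AddCommGroup M] [Module ℂ M] {a b : Module.End ℂ M} {f : M →ₗ[ℂ] Xi N}
    (hf : IsIsoOnto a b (xiA lam N) (xiB N) (cyclic (xiA lam N) (xiB N) (φ x)) f) :
    IsIsoOnto (changeA a b (θ x)) (changeB a b (θ x)) (xiA lam N) (xiB N)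
      (cyclic (xiA lam N) (xiB N) ((T x).symm (φ x))) ((T x).symm.toLinearMap.comp f) := by
  have hab := isABModule_xi lam N
  have hM := isABModule_of_isIsoOnto hφ hx hf
  obtain ⟨hinj, hran, hfa, hfb⟩ := hf
  refine ⟨(T x).symm.injective.comp hinj, ?_, fun v => ?_, fun v => ?_⟩
  · ext w
    rw [hφ'.mem_cyclic_iff hx, LinearMap.range_comp, hran, Submodule.mem_map]
    constructor
    · rintro ⟨z, hz, rfl⟩
      obtain ⟨S, hS⟩ := (exists_expansion_change_iff hab (hφ.rel x hx) (hc x) z).mpr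
        ((hφ.mem_cyclic_iff hx z).mp hz)
      exact ⟨S, by rw [← conjugation_symm_expansion hTa hTb hc, ← hS]; rfl⟩
    · rintro ⟨S, rfl⟩
      refine ⟨_, (hφ.mem_cyclic_iff hx _).mpr ((exists_expansion_change_iff hab (hφ.rel x hx)
        (hc x) _).mp ⟨S, rfl⟩), conjugation_symm_expansion hTa hTb hc x _ S⟩
  · have h := map_opSeries hM.toIsBComplete hM.isContracting hab.toIsBComplete hab.isContracting f
      hfb hfa (θ x) v
    rw [PowerSeries.map_id] at h
    rw [LinearMap.comp_apply, show f (changeA a b (θ x) v) = changeA _ _ _ (f v) from h]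
    exact conjugation_symm_changeA hTa x _
  · have h := map_changedB hM hab f hfa hfb (θ x) v
    rw [PowerSeries.map_id] at h
    rw [LinearMap.comp_apply, show f (changeB a b (θ x) v) = changeB _ _ _ (f v) from h]
    exact conjugation_symm_changeB hTb x _

variable (hθ : 𝒪.HolSeriesOn U θ)

include hθ

/-- The relation for α^k φ, rewritten with coefficients in β, is carried by T(x)⁻¹ to a relation of
the original kind with the same coefficients. -/
lemma HasRelation.conjugation (hφ : HasRelation 𝒪 U lam k φ S₀)
    (hol : HolMapOn 𝒪 U fun x => (T x).symm (φ x)) :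
    ∃ S₀' : Fin k → X → PowerSeries ℂ,
      HasRelation 𝒪 U lam k (fun x => (T x).symm (φ x)) S₀' := by
  have hab := isABModule_xi lam N
  obtain ⟨ψ, h1, h2⟩ := hφ.exists_inSpan_pow subset_rfl hθ fun x _ => hc x
  obtain ⟨S, hS, h3⟩ := (hφ.inSpan_change_iff subset_rfl hθ fun x _ => hc x).mpr h1
  refine ⟨S, hol, hS, fun x hx => ?_, fun x hx A B hAB => ?_⟩
  · rw [← conjugation_symm_changeA_pow hTa, h2 x hx, conjugation_symm_changeB hTb, h3 x hx,
      conjugation_symm_expansion hTa hTb hc]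
  · rw [← conjugation_symm_expansion hTa hTb hc, ← conjugation_symm_expansion hTa hTb hc] at hAB
    exact expansion_change_injective hab (hφ.rel x hx) (hφ.inj x hx) (hc x)
      ((T x).symm.injective hAB)

lemma HasRelation.isSectionAt_conjugation_iff {S₀' : Fin k → X → PowerSeries ℂ} (hU : IsOpen U)
    (hφ : HasRelation 𝒪 U lam k φ S₀)
    (hφ' : HasRelation 𝒪 U lam k (fun x => (T x).symm (φ x)) S₀') {y : X} (hy : y ∈ U) :
    IsSectionAt 𝒪 (fun _ => xiA lam N) (fun _ => xiB N) (fun x => (T x).symm (φ x)) y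
        (fun x => (T x).symm (ψ x)) ↔
      IsSectionAt 𝒪 (fun _ => xiA lam N) (fun _ => xiB N) φ y ψ := by
  rw [hφ'.isSectionAt_self_iff hU hy, hφ.isSectionAt_self_iff hU hy]
  refine exists_congr fun W => and_congr_right fun _ => and_congr_right fun _ =>
    and_congr_right fun hWU => ?_
  rw [inSpan_conjugation_iff hTa hTb hc]
  exact hφ.inSpan_change_iff hWU (HolSeriesOn_mono hWU hθ) fun x _ => hc x

end Families

/-! ### Holomorphic families and their sheaves under a change of variable. -/

section Main

universe u v

variable {X : Type u} [TopologicalSpace X] {𝒪 : ReducedComplexSpace X} {k : ℕ} {lam : ℚ}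
  {θ : X → PowerSeries ℂ} {E : X → Type v} [∀ x, AddCommGroup (E x)] [∀ x, Module ℂ (E x)]
  {a b : ∀ x, Module.End ℂ (E x)}

/-- A local trivialization of a family of themes gives one of the family obtained by a change of
variable. -/
theorem exists_local_change (hθ : IsRelativeChangeOfVariable 𝒪 θ) {U : Set X} (hU : IsOpen U)
    {N : ℕ} {φ : X → Xi N} (hφ : IsThematic 𝒪 U (fun _ => xiA lam N) (fun _ => xiB N) k φ) :
    ∃ (φ' : X → Xi N) (T : X → Xi N ≃ₗ[ℂ] Xi N),
      IsThematic 𝒪 U (fun _ => xiA lam N) (fun _ => xiB N) k φ' ∧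
      (∀ x ∈ U, ∀ f : E x →ₗ[ℂ] Xi N,
        IsIsoOnto (a x) (b x) (xiA lam N) (xiB N) (cyclic (xiA lam N) (xiB N) (φ x)) f →
        IsIsoOnto (changeA (a x) (b x) (θ x)) (changeB (a x) (b x) (θ x)) (xiA lam N) (xiB N)
          (cyclic (xiA lam N) (xiB N) (φ' x)) ((T x).symm.toLinearMap.comp f)) ∧
      ∀ y ∈ U, ∀ ψ : X → Xi N,
        IsSectionAt 𝒪 (fun _ => xiA lam N) (fun _ => xiB N) φ' y (fun x => (T x).symm (ψ x)) ↔
          IsSectionAt 𝒪 (fun _ => xiA lam N) (fun _ => xiB N) φ y ψ := by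
  obtain ⟨S₀, hS₀⟩ := hφ.exists_hasRelation hU
  obtain ⟨T, hTa, hTb, hT⟩ := exists_conjugation (lam := lam) N hθ.1 hθ.isChange
  have hθU : 𝒪.HolSeriesOn U θ := HolSeriesOn_mono (Set.subset_univ U) hθ.1
  obtain ⟨S₀', hS₀'⟩ := hS₀.conjugation hTa hTb hθ.isChange hθU (hT U φ hU hS₀.hol)
  exact ⟨fun x => (T x).symm (φ x), T, hS₀'.isThematic_self hU,
    fun x hx f hf => hS₀.isIsoOnto_conjugation hTa hTb hθ.isChange hS₀' hx hf,
    fun y hy ψ => hS₀.isSectionAt_conjugation_iff hTa hTb hθ.isChange hθU hU hS₀' hy⟩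

theorem IsHolomorphicFamily.change (hθ : IsRelativeChangeOfVariable 𝒪 θ)
    (h : IsHolomorphicFamily 𝒪 lam k a b) :
    IsHolomorphicFamily 𝒪 lam k (fun x => changeA (a x) (b x) (θ x))
      (fun x => changeB (a x) (b x) (θ x)) := by
  have loc : ∀ x₀ : X, ∃ U : Set X, IsOpen U ∧ x₀ ∈ U ∧ ∃ (N : ℕ) (φ : X → Xi N), 0 < N ∧
      IsThematic 𝒪 U (fun _ => xiA lam N) (fun _ => xiB N) k φ ∧
      ∀ x ∈ U, ∃ f : E x →ₗ[ℂ] Xi N, IsIsoOnto (changeA (a x) (b x) (θ x))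
        (changeB (a x) (b x) (θ x)) (xiA lam N) (xiB N) (cyclic (xiA lam N) (xiB N) (φ x)) f := by
    intro x₀
    obtain ⟨U, hU, hx₀, N, φ, hN, hφ, hf⟩ := h.2 x₀
    obtain ⟨φ', T, h1, h2, -⟩ := exists_local_change (a := a) (b := b) hθ hU hφ
    refine ⟨U, hU, hx₀, N, φ', hN, h1, fun x hx => ?_⟩
    obtain ⟨f, hf⟩ := hf x hx
    exact ⟨_, h2 x hx f hf⟩
  refine ⟨fun x => ?_, loc⟩
  -- That each transformed fibre is a theme is read off from the local trivialization around its
  -- point.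
  obtain ⟨U, -, hx, N, φ, hN, hφ, hf⟩ := loc x
  exact ⟨N, hN, φ x, hφ.rank x hx, hf x hx⟩

theorem IsHolomorphicSheaf.isHolomorphicFamily {sec : X → (∀ x, E x) → Prop}
    (h : IsHolomorphicSheaf 𝒪 lam k a b sec) : IsHolomorphicFamily 𝒪 lam k a b := by
  refine ⟨h.1, fun x₀ => ?_⟩
  obtain ⟨U, hU, hx₀, N, φ, hN, hφ, f, hf, -⟩ := h.2 x₀
  exact ⟨U, hU, hx₀, N, φ, hN, hφ, fun x hx => ⟨f x, hf x hx⟩⟩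

theorem IsHolomorphicSheaf.change (hθ : IsRelativeChangeOfVariable 𝒪 θ)
    {sec : X → (∀ x, E x) → Prop} (h : IsHolomorphicSheaf 𝒪 lam k a b sec) :
    IsHolomorphicSheaf 𝒪 lam k (fun x => changeA (a x) (b x) (θ x))
      (fun x => changeB (a x) (b x) (θ x)) sec := by
  refine ⟨(h.isHolomorphicFamily.change hθ).1, fun x₀ => ?_⟩
  obtain ⟨U, hU, hx₀, N, φ, hN, hφ, f, hf, hsec⟩ := h.2 x₀
  obtain ⟨φ', T, h1, h2, h3⟩ := exists_local_change (a := a) (b := b) hθ hU hφ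
  refine ⟨U, hU, hx₀, N, φ', hN, h1, fun x => (T x).symm.toLinearMap.comp (f x),
    fun x hx => h2 x hx (f x) (hf x hx), fun y hy s => ?_⟩
  rw [hsec y hy s, ← h3 y hy]
  rfl

end Main

end Theme

open Theme in
theorem mainTheorem7 {X : Type*} [TopologicalSpace X] [T2Space X] (𝒪 : ReducedComplexSpace X)
    (lam : ℚ) (hlam : 0 < lam) (k : ℕ) (θ : X → PowerSeries ℂ)
    (hθ : IsRelativeChangeOfVariable 𝒪 θ) :
    -- the key step, for the operators `α = θ(a)` and `β = b θ'(a)` on `Ξ_λ^{(N-1)}`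
    (∀ (N : ℕ) (_ : 0 < N) (φ : X → Xi N) (α β : X → Module.End ℂ (Xi N)),
      (∀ x, α x = changeA (xiA lam N) (xiB N) (θ x)) →
      (∀ x, β x = changeB (xiA lam N) (xiB N) (θ x)) →
      IsThematic 𝒪 Set.univ (fun _ => xiA lam N) (fun _ => xiB N) k φ →
        IsSheafBasis 𝒪 Set.univ β (IsSectionOn 𝒪 (fun _ => xiA lam N) (fun _ => xiB N) φ)
          (fun (i : Fin k) x => (α x ^ (i : ℕ)) (φ x)) ∧
        (∀ (V : Set X) (ψ : X → Xi N), IsOpen V →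
          IsSectionOn 𝒪 (fun _ => xiA lam N) (fun _ => xiB N) φ V ψ →
          IsSectionOn 𝒪 (fun _ => xiA lam N) (fun _ => xiB N) φ V (fun x => α x (ψ x))) ∧
        IsThematic 𝒪 Set.univ α β k φ) ∧
    -- the theorem, for a family of themes and for a family given with its sheaf of sections
    ∀ (E : X → Type*) [∀ x, AddCommGroup (E x)] [∀ x, Module ℂ (E x)]
      (a b : ∀ x, Module.End ℂ (E x)),
      (IsHolomorphicFamily 𝒪 lam k a b →
        IsHolomorphicFamily 𝒪 lam k (fun x => changeA (a x) (b x) (θ x))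
          (fun x => changeB (a x) (b x) (θ x))) ∧
      ∀ sec : X → (∀ x, E x) → Prop,
        IsHolomorphicSheaf 𝒪 lam k a b sec →
          IsHolomorphicSheaf 𝒪 lam k (fun x => changeA (a x) (b x) (θ x))
            (fun x => changeB (a x) (b x) (θ x)) sec := by
  have hc := hθ.isChange
  refine ⟨fun N _ φ α β hα hβ hφ => ?_, fun E _ _ a b => ⟨fun h => h.change hθ, fun sec h =>
    h.change hθ⟩⟩
  obtain rfl : α = fun x => changeA (xiA lam N) (xiB N) (θ x) := funext hα
  obtain rfl : β = fun x => changeB (xiA lam N) (xiB N) (θ x) := funext hβ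
  obtain ⟨S₀, hS₀⟩ := hφ.exists_hasRelation isOpen_univ
  have hsec : ∀ (V : Set X) (ψ : X → Xi N), IsOpen V → V ⊆ Set.univ →
      (IsSectionOn 𝒪 (fun _ => xiA lam N) (fun _ => xiB N) φ V ψ ↔
        InSpan 𝒪 (fun _ => xiA lam N) (fun _ => xiB N) k φ V ψ) :=
    fun _ _ hV hVU => hS₀.isSectionOn_self_iff isOpen_univ hV hVU
  refine ⟨hS₀.isSheafBasis hθ.1 (fun x _ => hc x) hsec, fun V ψ hV hψ => ?_,
    hS₀.isThematic isOpen_univ hθ.1 fun x _ => hc x⟩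
  rw [hsec _ _ hV (Set.subset_univ V)] at hψ ⊢
  exact hS₀.inSpan_changeA (Set.subset_univ V) (HolSeriesOn_mono (Set.subset_univ V) hθ.1)
    (fun x _ => hc x) hψ
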